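/- Let $0<q<1$ and write $\int_0^\infty\phi(x)\,d_{\sqrt q}x=(1-\sqrt q)\sum_{i\in\mathbb Z}q^{i/2}\phi(q^{i/2})$. On the lattice $q^{\mathbb Z/2}$ let $F(q^{i/2})=1+\sqrt q$ for $i$ even and $F(q^{i/2})=0$ for $i$ odd, and let $s(q^{i/2},q^{j/2})$ be equal to $(1+\sqrt q)^2$ if $i=2m+1$, $j=2n$ with $m\ge n$, to $-(1+\sqrt q)^2$ if $i=2n$, $j=2m+1$ with $m\ge n$, and to $0$ otherwise. Let $\rho$ be a real $q$-classical weight on $q^{\mathbb Z/2}$: there are polynomials $f,g$ with $\deg f\le 2$, $\deg g\le1$ such that $f(\sqrt q x)\rho(\sqrt q x)=\big(f(x)-(1-\sqrt q)xg(x)\big)\rho(x)$ for all $x\in q^{\mathbb Z/2}$; the weight $\rho$ is nonzero on the whole lattice (interval $(0,\infty)$), or it is nonzero exactly at the lattice points of an interval $(0,b]$ with $b\in q^{\mathbb Z}$ and extended by zero. Let $\omega$ be a weight with the same support satisfying $\omega(x)\omega(\sqrt q x)f(\sqrt q x)=\rho(x)$ for all $x\in q^{\mathbb Z/2}$. All moments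 $\int_0^\infty x^k\rho\,d_{\sqrt q}x$ and $\int_0^\infty x^k\omega\,d_{\sqrt q}x$, $k\ge0$, are assumed to converge absolutely, and $$\lim_{x\to0,\;x\in q^{\mathbb Z/2}}\rho(x)/\omega(x)=0 .$$ Put $\langle\phi,\psi\rangle_2=\int_0^\infty\phi\psi\rho\,d_{\sqrt q}x$, $\langle\phi,\psi\rangle_1=\int_0^\infty\!\int_0^\infty\phi(x)\psi(y)s(x,y)\omega(x)\omega(y)\,d_{\sqrt q}x\,d_{\sqrt q}y$ and $s_x\phi(x)=\int_0^\infty s(z,x)\phi(z)\omega(z)\,d_{\sqrt q}z$. Let $(p_n)_{n\ge0}$ be monic polynomials, $\deg p_n=n$, with $\langle p_m,p_n\rangle_2=h_n\delta_{mn}$, $h_n\ne0$, and let $(Q_n)_{n\ge0}$ be monic polynomials, $\deg Q_n=n$, with $\langle Q_{2m},Q_{2n}\rangle_1=\langle Q_{2m+1},Q_{2n+1}\rangle_1=0$ and $\langle Q_{2m},Q_{2n+1}\rangle_1=u_m\delta_{mn}$, $u_m\neq0$. Define $\beta_k=\int_0^\infty F Q_k\,\omega\,d_{\sqrt q}x$,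 $$\gamma_j=\frac{-\langle p_{j+1},\mathcal A_qp_j\rangle_2}{(1+\sqrt q)^2h_jh_{j+1}},\qquad \mathcal A_q\phi(x)=g(x)\phi(\sqrt q x)+q^{-1/2}f(x)D_{q^{-1/2}}\phi(x)+f(x)D_{q^{1/2}}\phi(x),$$ where $D_r\phi(x)=\frac{\phi(x)-\phi(rx)}{(1-r)x}$, and the kernels $$S_N(x,y)=\sum_{l=0}^{N-1}\frac{p_l(x)p_l(y)}{h_l},\qquad K_{2n}(x,y)=\sum_{k=0}^{n-1}\frac{Q_{2k}(x)Q_{2k+1}(y)-Q_{2k}(y)Q_{2k+1}(x)}{u_k},\qquad J_{2n}(x,y)=s_xK_{2n}(x,y).$$ Fix $n\ge1$ with $\beta_{2n}\neq0$, and let $\hat Q_k=Q_k-\frac{\beta_k}{\beta_{2n}}Q_{2n}$ for $0\le k<2n$, $\hat Q_{2n}=Q_{2n}$, $\Phi_k=s_x\hat Q_k$, and $$J^{odd}_{2n+1}(x,y)=\sum_{k=0}^{n-1}\frac{1}{u_k}\big(\Phi_{2k}(x)\hat Q_{2k+1}(y)-\Phi_{2k+1}(x)\hat Q_{2k}(y)\big)+\frac{1}{\beta_{2n}}F(x)\hat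 Q_{2n}(y).$$ Then for all $x\in q^{\mathbb Z/2}$ and all $y\in\mathbb R$ $$J^{odd}_{2n+1}(x,y)=J_{2n}(x,y)+\frac{1}{\beta_{2n}}F(x)p_{2n}(y)-\frac{\beta_{2n-2}}{u_{n-1}\beta_{2n}}\Big(s_xp_{2n}(x)\,p_{2n-1}(y)-s_xp_{2n-1}(x)\,p_{2n}(y)\Big),$$ and, for all $x$ in the support of $\rho$ and all $y\in\mathbb R$, $$J^{odd}_{2n+1}(x,y)=\frac{\rho(x)}{\omega(x)}S_{2n-1}(x,y)+\gamma_{2n-2}\big(s_xp_{2n-2}(x)\big)p_{2n-1}(y)+\frac{1}{\beta_{2n}}F(x)p_{2n}(y)-\frac{\beta_{2n-2}}{u_{n-1}\beta_{2n}}\Big(s_xp_{2n}(x)\,p_{2n-1}(y)-s_xp_{2n-1}(x)\,p_{2n}(y)\Big).$$ -/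

import Mathlib

noncomputable section

namespace QOrtho

open Polynomial

/-- The point `q^{i/2}` of the exponential lattice `q^{ℤ/2}`. -/
def pt (q : ℝ) (i : ℤ) : ℝ := (√q) ^ i

/-- The integral over `(0,∞)` with respect to `d_{√q} x` of a function on the lattice `q^{ℤ/2}`
(`φ i` is the value of the function at `q^{i/2}`). -/
def qInt (q : ℝ) (φ : ℤ → ℝ) : ℝ := (1 - √q) * ∑' i : ℤ, pt q i * φ i

/-- All moments of the weight `w` are absolutely convergent. -/
def HasMoments (q : ℝ) (w : ℝ → ℝ) : Prop :=
  ∀ k : ℕ, Summable fun i : ℤ => pt q i * (pt q i ^ k * w (pt q i))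

/-- The inner product `⟨φ, ψ⟩_{2,ρ}`. -/
def inner2 (q : ℝ) (ρ φ ψ : ℝ → ℝ) : ℝ :=
  qInt q fun i => φ (pt q i) * ψ (pt q i) * ρ (pt q i)

/-- The skew symmetric kernel `s(q^{i/2}, q^{j/2})`: equal to `(1+√q)²` if `i = 2m+1`, `j = 2n`
with `m ≥ n`, to `-(1+√q)²` if `i = 2n`, `j = 2m+1` with `m ≥ n`, and to `0` otherwise. -/
def sKer (q : ℝ) (i j : ℤ) : ℝ :=
  (1 + √q) ^ 2 *
    (if Odd i ∧ Even j ∧ j < i then 1 else if Even i ∧ Odd j ∧ i < j then -1 else 0)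

/-- `F(q^{i/2})`: equal to `1 + √q` on `q^ℤ` and to `0` on `q^{ℤ+1/2}`. -/
def F (q : ℝ) (i : ℤ) : ℝ := if Even i then 1 + √q else 0

/-- The skew inner product `⟨φ, ψ⟩_{1,ω} = ∫∫ φ(x) ψ(y) s(x,y) ω(x) ω(y) d_{√q}x d_{√q}y`. -/
def skew1 (q : ℝ) (ω φ ψ : ℝ → ℝ) : ℝ :=
  qInt q fun j => qInt q fun i =>
    φ (pt q i) * ψ (pt q j) * sKer q i j * ω (pt q i) * ω (pt q j)

/-- `(s_x φ)(q^{j/2}) = ∫ s(z, q^{j/2}) φ(z) ω(z) d_{√q}z`. -/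
def sOp (q : ℝ) (ω φ : ℝ → ℝ) (j : ℤ) : ℝ :=
  qInt q fun i => sKer q i j * φ (pt q i) * ω (pt q i)

/-- The difference operator `(D_r φ)(x) = (φ(x) - φ(r x)) / ((1 - r) x)`. -/
def qDiff (r : ℝ) (φ : ℝ → ℝ) (x : ℝ) : ℝ := (φ x - φ (r * x)) / ((1 - r) * x)

/-- The operator `𝒜_q = g T_{√q} + q^{-1/2} f D_{q^{-1/2}} + f D_{√q}`, where
`(T_{√q} φ)(x) = φ(√q x)`. -/
def opA (q : ℝ) (f g : ℝ[X]) (φ : ℝ → ℝ) (x : ℝ) : ℝ :=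
  g.eval x * φ (√q * x) + (√q)⁻¹ * f.eval x * qDiff (√q)⁻¹ φ x + f.eval x * qDiff (√q) φ x

/-- `ρ` is a `q`-classical weight with Pearson pair `(f, g)`. The Pearson equation
`ρ(√q x) / ρ(x) = (f(x) - (1-√q) x g(x)) / f(√q x)` is cleared of denominators. The weight lives
either on the whole lattice (interval `(0,∞)`) or on `(0,b]` with `b = q^N`, `N ∈ ℤ`; in the latter
case it is extended by zero. -/
structure IsQClassical (q : ℝ) (ρ : ℝ → ℝ) (f g : ℝ[X]) : Prop where
  natDegree_f : f.natDegree ≤ 2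
  natDegree_g : g.natDegree ≤ 1
  pearson : ∀ i : ℤ, f.eval (√q * pt q i) * ρ (√q * pt q i) =
    (f.eval (pt q i) - (1 - √q) * pt q i * g.eval (pt q i)) * ρ (pt q i)
  support : (∀ i : ℤ, ρ (pt q i) ≠ 0) ∨ ∃ N : ℤ, ∀ i : ℤ, ρ (pt q i) ≠ 0 ↔ 2 * N ≤ i
  moments : HasMoments q ρ

/-- `ω` is the weight for the skew inner product attached to `ρ`: it has the same support on the
lattice and `ω(x) ω(√q x) = ρ(x) / f(√q x)` (cleared of the denominator). -/
structure IsSkewWeight (q : ℝ) (ρ : ℝ → ℝ) (f : ℝ[X]) (ω : ℝ → ℝ) : Prop where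
  support_iff : ∀ i : ℤ, ω (pt q i) ≠ 0 ↔ ρ (pt q i) ≠ 0
  rel : ∀ i : ℤ, ω (pt q i) * ω (√q * pt q i) * f.eval (√q * pt q i) = ρ (pt q i)
  moments : HasMoments q ω

/-- `h_n = ⟨p_n, p_n⟩_{2,ρ}`. -/
def h (q : ℝ) (ρ : ℝ → ℝ) (p : ℕ → ℝ[X]) (n : ℕ) : ℝ :=
  inner2 q ρ (fun x => (p n).eval x) (fun x => (p n).eval x)

/-- `(p_n)` are the monic orthogonal polynomials for `⟨·,·⟩_{2,ρ}`, with nonzero norms. -/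
structure IsMonicOP (q : ℝ) (ρ : ℝ → ℝ) (p : ℕ → ℝ[X]) : Prop where
  monic : ∀ n, (p n).Monic
  natDegree_eq : ∀ n, (p n).natDegree = n
  orthogonal : ∀ m n, m ≠ n →
    inner2 q ρ (fun x => (p m).eval x) (fun x => (p n).eval x) = 0
  norm_ne_zero : ∀ n, h q ρ p n ≠ 0

/-- `u_m = ⟨Q_{2m}, Q_{2m+1}⟩_{1,ω}`. -/
def u (q : ℝ) (ω : ℝ → ℝ) (Q : ℕ → ℝ[X]) (m : ℕ) : ℝ :=
  skew1 q ω (fun x => (Q (2 * m)).eval x) (fun x => (Q (2 * m + 1)).eval x)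

/-- `(Q_n)` are monic skew orthogonal polynomials for `⟨·,·⟩_{1,ω}`, with nonzero
normalisation factors `u_m`. -/
structure IsMonicSOP (q : ℝ) (ω : ℝ → ℝ) (Q : ℕ → ℝ[X]) : Prop where
  monic : ∀ n, (Q n).Monic
  natDegree_eq : ∀ n, (Q n).natDegree = n
  even_even : ∀ m n,
    skew1 q ω (fun x => (Q (2 * m)).eval x) (fun x => (Q (2 * n)).eval x) = 0
  odd_odd : ∀ m n,
    skew1 q ω (fun x => (Q (2 * m + 1)).eval x) (fun x => (Q (2 * n + 1)).eval x) = 0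
  even_odd : ∀ m n, m ≠ n →
    skew1 q ω (fun x => (Q (2 * m)).eval x) (fun x => (Q (2 * n + 1)).eval x) = 0
  u_ne_zero : ∀ m, u q ω Q m ≠ 0

/-- `c_j = -⟨p_{j+1}, 𝒜_q p_j⟩_{2,ρ}`. -/
def c (q : ℝ) (ρ : ℝ → ℝ) (f g : ℝ[X]) (p : ℕ → ℝ[X]) (j : ℕ) : ℝ :=
  -inner2 q ρ (fun x => (p (j + 1)).eval x) (opA q f g fun x => (p j).eval x)

/-- `γ_j = c_j / ((1+√q)² h_j h_{j+1})`. -/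
def gam (q : ℝ) (ρ : ℝ → ℝ) (f g : ℝ[X]) (p : ℕ → ℝ[X]) (j : ℕ) : ℝ :=
  c q ρ f g p j / ((1 + √q) ^ 2 * h q ρ p j * h q ρ p (j + 1))

/-- The classical Christoffel–Darboux kernel `S_N(x,y) = ∑_{l=0}^{N-1} p_l(x) p_l(y) / h_l`. -/
def S (q : ℝ) (ρ : ℝ → ℝ) (p : ℕ → ℝ[X]) (N : ℕ) (x y : ℝ) : ℝ :=
  ∑ l ∈ Finset.range N, (p l).eval x * (p l).eval y / h q ρ p l

/-- The skew kernel `K_{2n}(x,y)`. -/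
def K (q : ℝ) (ω : ℝ → ℝ) (Q : ℕ → ℝ[X]) (n : ℕ) (x y : ℝ) : ℝ :=
  ∑ k ∈ Finset.range n, 1 / u q ω Q k *
    ((Q (2 * k)).eval x * (Q (2 * k + 1)).eval y - (Q (2 * k)).eval y * (Q (2 * k + 1)).eval x)

/-- `J_{2n}(x,y) = s_x K_{2n}(x,y)` at `x = q^{i/2}`. -/
def J (q : ℝ) (ω : ℝ → ℝ) (Q : ℕ → ℝ[X]) (n : ℕ) (i : ℤ) (y : ℝ) : ℝ :=
  sOp q ω (fun z => K q ω Q n z y) i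

/-- `β_k = ∫ F(x) Q_k(x) ω(x) d_{√q}x`. -/
def bet (q : ℝ) (ω : ℝ → ℝ) (Q : ℕ → ℝ[X]) (k : ℕ) : ℝ :=
  qInt q fun i => F q i * (Q k).eval (pt q i) * ω (pt q i)

/-- `Q̂_k = Q_k - (β_k / β_{2n}) Q_{2n}` for `k < 2n`, and `Q̂_{2n} = Q_{2n}`
(only the indices `k ≤ 2n` are used). -/
def Qhat (q : ℝ) (ω : ℝ → ℝ) (Q : ℕ → ℝ[X]) (n k : ℕ) : ℝ[X] :=
  if k < 2 * n then Q k - C (bet q ω Q k / bet q ω Q (2 * n)) * Q (2 * n) else Q k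

/-- `Φ_k(x) = ∫ Q̂_k(z) s(z,x) ω(z) d_{√q}z` at `x = q^{i/2}`. -/
def Phi (q : ℝ) (ω : ℝ → ℝ) (Q : ℕ → ℝ[X]) (n k : ℕ) (i : ℤ) : ℝ :=
  sOp q ω (fun z => (Qhat q ω Q n k).eval z) i

/-- The odd kernel `J^{odd}_{2n+1}(x,y)` at `x = q^{i/2}`. -/
def Jodd (q : ℝ) (ω : ℝ → ℝ) (Q : ℕ → ℝ[X]) (n : ℕ) (i : ℤ) (y : ℝ) : ℝ :=
  ∑ k ∈ Finset.range n, 1 / u q ω Q k *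
      (Phi q ω Q n (2 * k) i * (Qhat q ω Q n (2 * k + 1)).eval y -
        Phi q ω Q n (2 * k + 1) i * (Qhat q ω Q n (2 * k)).eval y) +
    1 / bet q ω Q (2 * n) * F q i * (Qhat q ω Q n (2 * n)).eval y

end QOrtho

end

noncomputable section

namespace QOrtho

open Polynomial Filter Topology

/-! Write B for `⟨·,·⟩_1`, I for `⟨·,·⟩_2`, κ = (1+√q)² and A for `𝒜_q`. Everything rests on the
identity s(Aφ) = κ(ρ/ω)φ on the support (`sLin_polyA`). The kernel s inverts a two-step difference:
s(x,·) jumps only at x (`sKer_sub`). By the Pearson equation, (1-√q)xω·Aφ is the same two-step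
difference of (ρ/ω)φ (`ratio_step`). So the two sides of the identity differ by a constant on each
parity class of the lattice. The odd constant vanishes by letting x → ∞, the even one by letting x →
0.

Integrating the identity against ψω gives B(Aφ,ψ) = κ I(φ,ψ) (`skewForm_polyA`). Letting x → 0
through odd points gives ∫F·Aφ·ω = 0 (`betaLin_polyA`).

The rest is linear algebra. A raises degrees by at most one and is antisymmetric for I, so A p_k =
a_k p_{k+1} - b_k p_{k-1}. Vanishing of a functional on the range of A therefore propagates along
the p_k in steps of two. This yields Q_{2m} = p_{2m} (`even_eq`) and the value of u_m, hence γ_{2m}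
= 1/u_m (`gam_even_eq`). Since K_{2n}(·,y) represents minus evaluation at y, it equals κ⁻¹A
S_{2n-1}(·,y) + p_{2n-1}(y)p_{2n-2}/u_{n-1} (`skewKernel_eq_ladder`); applying s turns the first
term into (ρ/ω)S_{2n-1}.

Passing from Q_k to Q̂_k changes the even kernel only by a skew combination of Q_{2n} and the
B-representer of φ ↦ ∫Fφω below degree 2n (`Jodd_eq`). That functional kills the range of A, so its
representer is (β_{2n-2}/u_{n-1}) p_{2n-1} (`skewDual_eq`). -/

/-! ### Functionals on monic polynomial sequences -/

theorem degree_sub_coeff_smul_lt {P : ℕ → ℝ[X]} (hm : ∀ n, (P n).Monic)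
    (hd : ∀ n, (P n).natDegree = n) {φ : ℝ[X]} {m : ℕ} (hφ : φ.degree < (m + 1 : ℕ)) :
    (φ - φ.coeff m • P m).degree < m := by
  rw [degree_lt_iff_coeff_zero] at hφ ⊢
  intro k hk
  rcases hk.eq_or_lt with rfl | hk
  · have : (P m).coeff m = 1 := by
      have := (hm m).coeff_natDegree
      rwa [hd] at this
    simp [this]
  · have : (P m).coeff k = 0 := coeff_eq_zero_of_natDegree_lt (by rw [hd]; exact hk)
    simp [this, hφ k hk]

/-- A linear functional vanishing on the first `m` members of a monic sequence vanishes on all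
polynomials of degree less than `m`. -/
theorem functional_eq_zero {P : ℕ → ℝ[X]} (hm : ∀ n, (P n).Monic)
    (hd : ∀ n, (P n).natDegree = n) (Λ : ℝ[X] →ₗ[ℝ] ℝ) {m : ℕ} (h : ∀ k < m, Λ (P k) = 0)
    {φ : ℝ[X]} (hφ : φ.degree < m) : Λ φ = 0 := by
  induction m generalizing φ with
  | zero =>
    have : φ = 0 := by simpa using hφ
    simp [this]
  | succ m ih =>
    have h1 := ih (fun k hk => h k (by omega)) (degree_sub_coeff_smul_lt hm hd hφ)
    rw [map_sub, map_smul, h m (by omega)] at h1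
    simpa using h1

/-- A polynomial of degree less than `m` killed by a triangular system of functionals is zero. -/
theorem eq_zero_of_triangular {P : ℕ → ℝ[X]} (hm : ∀ n, (P n).Monic)
    (hd : ∀ n, (P n).natDegree = n) (Λ : ℕ → ℝ[X] →ₗ[ℝ] ℝ)
    (hlt : ∀ k j, j < k → Λ k (P j) = 0) (hne : ∀ k, Λ k (P k) ≠ 0) {m : ℕ} {φ : ℝ[X]}
    (hφ : φ.degree < m) (h : ∀ k < m, Λ k φ = 0) : φ = 0 := by
  induction m with
  | zero => simpa using hφ
  | succ m ih =>
    have h1 := functional_eq_zero hm hd (Λ m) (hlt m) (degree_sub_coeff_smul_lt hm hd hφ)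
    have h0 : φ.coeff m = 0 := by
      rw [map_sub, map_smul, h m (by omega)] at h1
      simpa [hne m] using h1
    have h2 := degree_sub_coeff_smul_lt hm hd hφ
    rw [h0, zero_smul, sub_zero] at h2
    exact ih h2 fun k hk => h k (by omega)

/-! ### Linear algebra of the skew ladder -/

/-- A bilinear form `I` and a skew form `B` related by an operator `A` raising degrees by at most
one, through `B (A φ) ψ = κ * I φ ψ`, together with monic orthogonal polynomials `P` for `I`. -/
structure IsSkewLadder (κ : ℝ) (A : ℝ[X] →ₗ[ℝ] ℝ[X]) (I B : ℝ[X] →ₗ[ℝ] ℝ[X] →ₗ[ℝ] ℝ)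
    (P : ℕ → ℝ[X]) : Prop where
  kappa_ne : κ ≠ 0
  monic : ∀ n, (P n).Monic
  natDegree_eq : ∀ n, (P n).natDegree = n
  orth : ∀ m n, m ≠ n → I (P m) (P n) = 0
  norm_ne : ∀ n, I (P n) (P n) ≠ 0
  skew : ∀ φ ψ, B φ ψ = -B ψ φ
  adj : ∀ φ ψ, B (A φ) ψ = κ * I φ ψ
  degree_lt : ∀ (φ : ℝ[X]) (m : ℕ), φ.degree < m → (A φ).degree < (m + 1 : ℕ)

/-- Monic skew orthogonal polynomials for the skew form `B`. -/
structure IsSkewOrtho (B : ℝ[X] →ₗ[ℝ] ℝ[X] →ₗ[ℝ] ℝ) (Q : ℕ → ℝ[X]) : Prop where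
  monic : ∀ n, (Q n).Monic
  natDegree_eq : ∀ n, (Q n).natDegree = n
  skew : ∀ φ ψ, B φ ψ = -B ψ φ
  even_even : ∀ m n, B (Q (2 * m)) (Q (2 * n)) = 0
  odd_odd : ∀ m n, B (Q (2 * m + 1)) (Q (2 * n + 1)) = 0
  even_odd : ∀ m n, m ≠ n → B (Q (2 * m)) (Q (2 * n + 1)) = 0
  ne_zero : ∀ m, B (Q (2 * m)) (Q (2 * m + 1)) ≠ 0

theorem degree_lt_of_natDegree_eq {P : ℕ → ℝ[X]} (hd : ∀ n, (P n).natDegree = n) {k m : ℕ}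
    (hk : k < m) : (P k).degree < m :=
  lt_of_le_of_lt degree_le_natDegree (by rw [hd]; exact_mod_cast hk)

theorem degree_sub_lt_of_monic {P Q : ℕ → ℝ[X]} (hP : ∀ n, (P n).Monic)
    (hPd : ∀ n, (P n).natDegree = n) (hQ : ∀ n, (Q n).Monic) (hQd : ∀ n, (Q n).natDegree = n)
    (m : ℕ) : (Q m - P m).degree < m := by
  have h1 : (Q m).coeff m = 1 := by simpa [hQd] using (hQ m).coeff_natDegree
  have h2 := degree_sub_coeff_smul_lt hP hPd
    (degree_lt_of_natDegree_eq hQd (Nat.lt_succ_self m))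
  rwa [h1, one_smul] at h2

namespace IsSkewOrtho

variable {B : ℝ[X] →ₗ[ℝ] ℝ[X] →ₗ[ℝ] ℝ} {Q : ℕ → ℝ[X]}

theorem odd_even (hQ : IsSkewOrtho B Q) {m n : ℕ} (h : m ≠ n) :
    B (Q (2 * m + 1)) (Q (2 * n)) = 0 := by
  rw [hQ.skew, hQ.even_odd n m h.symm, neg_zero]

/-- The skew form is nondegenerate on polynomials of degree less than `2 * n`. -/
theorem eq_zero (hQ : IsSkewOrtho B Q) {n : ℕ} {φ : ℝ[X]} (hφ : φ.degree < (2 * n : ℕ))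
    (h : ∀ k < 2 * n, B φ (Q k) = 0) : φ = 0 := by
  -- Each index is tested against its skew partner (2a with 2a+1), which makes the system diagonal.
  -- The bound 2n is even, so partners of indices below it stay below it.
  refine eq_zero_of_triangular hQ.monic hQ.natDegree_eq
    (fun k => B.flip (Q (if Even k then k + 1 else k - 1))) ?_ ?_ hφ ?_
  · intro k j hjk
    rw [LinearMap.flip_apply]
    rcases Nat.even_or_odd' k with ⟨a, rfl | rfl⟩ <;> rcases Nat.even_or_odd' j with ⟨b, rfl | rfl⟩
    · simpa using hQ.even_odd b a (by omega)
    · simpa using hQ.odd_odd b a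
    · simpa using hQ.even_even b a
    · simpa using hQ.odd_even (m := b) (n := a) (by omega)
  · intro k
    rw [LinearMap.flip_apply]
    rcases Nat.even_or_odd' k with ⟨a, rfl | rfl⟩
    · simpa using hQ.ne_zero a
    · rw [hQ.skew]
      simpa using hQ.ne_zero a
  · intro k hk
    rw [LinearMap.flip_apply]
    apply h
    rcases Nat.even_or_odd' k with ⟨a, rfl | rfl⟩
    · simp; omega
    · simp; omega

end IsSkewOrtho

namespace IsSkewLadder

variable {κ : ℝ} {A : ℝ[X] →ₗ[ℝ] ℝ[X]} {I B : ℝ[X] →ₗ[ℝ] ℝ[X] →ₗ[ℝ] ℝ} {P : ℕ → ℝ[X]}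

theorem degree_P_lt (H : IsSkewLadder κ A I B P) {k m : ℕ} (hk : k < m) : (P k).degree < m :=
  degree_lt_of_natDegree_eq H.natDegree_eq hk

theorem degree_A_P_lt (H : IsSkewLadder κ A I B P) {k m : ℕ} (hk : k + 1 < m) :
    (A (P k)).degree < m := by
  obtain ⟨m, rfl⟩ : ∃ j, m = j + 1 := ⟨m - 1, by omega⟩
  exact H.degree_lt _ _ (H.degree_P_lt (by omega))

theorem form_self (H : IsSkewLadder κ A I B P) (φ : ℝ[X]) : B φ φ = 0 := by
  have := H.skew φ φ
  linarith

/-- Evaluate B(Aφ, Aψ) by adjointness in both orders and use that B is skew. -/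
theorem A_skew (H : IsSkewLadder κ A I B P) (φ ψ : ℝ[X]) : I φ (A ψ) = -I ψ (A φ) := by
  have h := H.skew (A φ) (A ψ)
  rw [H.adj, H.adj] at h
  apply mul_left_cancel₀ H.kappa_ne
  linarith

theorem eq_of_inner (H : IsSkewLadder κ A I B P) {m : ℕ} {φ ψ : ℝ[X]} (hφ : φ.degree < m)
    (hψ : ψ.degree < m) (h : ∀ k < m, I (P k) φ = I (P k) ψ) : φ = ψ := by
  rw [← sub_eq_zero]
  refine eq_zero_of_triangular H.monic H.natDegree_eq (fun k => I (P k))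
    (fun k j hj => H.orth k j (by omega)) H.norm_ne
    (lt_of_le_of_lt (degree_sub_le _ _) (max_lt hφ hψ)) fun k hk => ?_
  rw [map_sub, h k hk, sub_self]

theorem inner_P_eq_zero (H : IsSkewLadder κ A I B P) {k : ℕ} {φ : ℝ[X]} (hφ : φ.degree < k) :
    I (P k) φ = 0 :=
  functional_eq_zero H.monic H.natDegree_eq (I (P k)) (fun j hj => H.orth k j (by omega)) hφ

/-- A is tridiagonal with zero diagonal: the degree bound gives one side, antisymmetry reflects it
to the other and kills the diagonal. -/
theorem inner_A_eq_zero (H : IsSkewLadder κ A I B P) {j k : ℕ} (h : j + 1 ≠ k) (h' : k + 1 ≠ j) :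
    I (P j) (A (P k)) = 0 := by
  rcases lt_trichotomy j k with hjk | rfl | hjk
  · rw [H.A_skew, H.inner_P_eq_zero (H.degree_A_P_lt (by omega)), neg_zero]
  · have := H.A_skew (P j) (P j)
    linarith
  · exact H.inner_P_eq_zero (H.degree_A_P_lt (by omega))

theorem A_zero (H : IsSkewLadder κ A I B P) :
    A (P 0) = (I (P 1) (A (P 0)) / I (P 1) (P 1)) • P 1 := by
  refine H.eq_of_inner (m := 2) (H.degree_A_P_lt (by omega))
    (lt_of_le_of_lt (degree_smul_le _ _) (H.degree_P_lt (by omega))) fun k hk => ?_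
  rw [map_smul, smul_eq_mul]
  interval_cases k
  · rw [H.inner_A_eq_zero (by omega) (by omega), H.orth 0 1 (by omega), mul_zero]
  · rw [div_mul_cancel₀ _ (H.norm_ne 1)]

/-- By antisymmetry the lowering coefficient of A on P_{k+1} comes from the raising entry I(P_{k+1},
A P_k). Nonvanishing of the even raising entries thus also lets one descend through even indices. -/
theorem A_succ (H : IsSkewLadder κ A I B P) (k : ℕ) :
    A (P (k + 1)) = (I (P (k + 2)) (A (P (k + 1))) / I (P (k + 2)) (P (k + 2))) • P (k + 2) -
      (I (P (k + 1)) (A (P k)) / I (P k) (P k)) • P k := by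
  refine H.eq_of_inner (m := k + 3) (H.degree_A_P_lt (by omega))
    (lt_of_le_of_lt (degree_sub_le _ _) (max_lt
      (lt_of_le_of_lt (degree_smul_le _ _) (H.degree_P_lt (by omega)))
      (lt_of_le_of_lt (degree_smul_le _ _) (H.degree_P_lt (by omega))))) fun j hj => ?_
  rw [map_sub, map_smul, map_smul, smul_eq_mul, smul_eq_mul]
  by_cases h1 : j = k + 2
  · subst h1
    rw [H.orth (k + 2) k (by omega), div_mul_cancel₀ _ (H.norm_ne _)]
    ring
  by_cases h2 : j = k
  · subst h2
    rw [H.orth j (j + 2) (by omega), div_mul_cancel₀ _ (H.norm_ne _), H.A_skew]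
    ring
  rw [H.inner_A_eq_zero (by omega) (by omega), H.orth j (k + 2) h1, H.orth j k h2]
  ring

/-- Climb from A P_0, a multiple of P_1: each A P_{2j} links P_{2j-1} to P_{2j+1}. -/
theorem functional_odd (H : IsSkewLadder κ A I B P) (Λ : ℝ[X] →ₗ[ℝ] ℝ) {m : ℕ}
    (ha : ∀ j < m, I (P (2 * j + 1)) (A (P (2 * j))) ≠ 0)
    (hΛ : ∀ j < m, Λ (A (P (2 * j))) = 0) : ∀ j < m, Λ (P (2 * j + 1)) = 0 := by
  intro j
  induction j with
  | zero =>
    intro hj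
    have h := hΛ 0 hj
    rw [mul_zero, H.A_zero, map_smul, smul_eq_mul, mul_eq_zero] at h
    exact h.resolve_left (div_ne_zero (ha 0 hj) (H.norm_ne 1))
  | succ j ih =>
    intro hj
    have h := hΛ (j + 1) hj
    rw [show 2 * (j + 1) = 2 * j + 1 + 1 by ring, H.A_succ, map_sub, map_smul, map_smul,
      ih (by omega), smul_zero, sub_zero, smul_eq_mul, mul_eq_zero] at h
    exact h.resolve_left (div_ne_zero (ha (j + 1) hj) (H.norm_ne _))

/-- If the raising entry vanished, A P_{2k} would be a multiple of P_{2k-1} (or zero). But B(·,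
P_{2k}) kills A P_{2j} for j < k, hence P_{2k-1}, against B(A P_{2k}, P_{2k}) = κ I(P_{2k}, P_{2k})
≠ 0. -/
theorem raise_ne_zero (H : IsSkewLadder κ A I B P) (k : ℕ) :
    I (P (2 * k + 1)) (A (P (2 * k))) ≠ 0 := by
  induction k using Nat.strong_induction_on with
  | _ k ih =>
    intro h0
    apply mul_ne_zero H.kappa_ne (H.norm_ne (2 * k))
    rw [← H.adj]
    cases k with
    | zero =>
      rw [mul_zero] at h0 ⊢
      rw [H.A_zero, h0, zero_div, zero_smul, map_zero, LinearMap.zero_apply]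
    | succ k =>
      have h1 := H.functional_odd (B.flip (P (2 * (k + 1)))) (m := k + 1)
        (fun j hj => ih j hj) (fun j hj => by
          rw [LinearMap.flip_apply, H.adj, H.orth _ _ (by omega), mul_zero]) k (by omega)
      rw [LinearMap.flip_apply] at h1
      rw [show 2 * (k + 1) = 2 * k + 1 + 1 by ring] at h0 h1 ⊢
      rw [H.A_succ, h0, zero_div, zero_smul, zero_sub, map_neg, map_smul, LinearMap.neg_apply,
        LinearMap.smul_apply, h1, smul_zero, neg_zero]

/-- A functional vanishing on `A (P k)` for `k < 2 * m` and on `P (2 * m)` vanishes on all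
polynomials of degree at most `2 * m`. -/
theorem functional_vanish (H : IsSkewLadder κ A I B P) (Λ : ℝ[X] →ₗ[ℝ] ℝ) {m : ℕ}
    (hΛ : ∀ k < 2 * m, Λ (A (P k)) = 0) (htop : Λ (P (2 * m)) = 0) :
    ∀ k < 2 * m + 1, Λ (P k) = 0 := by
  -- Odd indices climb from P_1, but even ones have no such start; they descend from P_{2m},
  -- dividing by the lowering coefficient of A P_{2i+1}.
  have heven : ∀ j i, i + j = m → Λ (P (2 * i)) = 0 := by
    intro j
    induction j with
    | zero => rintro i rfl; exact htop
    | succ j ih =>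
      intro i hi
      have h1 := ih (i + 1) (by omega)
      have h2 := hΛ (2 * i + 1) (by omega)
      rw [show 2 * (i + 1) = 2 * i + 2 by ring] at h1
      rw [H.A_succ, map_sub, map_smul, map_smul, h1, smul_zero, zero_sub, smul_eq_mul,
        neg_eq_zero, mul_eq_zero] at h2
      exact h2.resolve_left (div_ne_zero (H.raise_ne_zero i) (H.norm_ne _))
  intro k hk
  rcases Nat.even_or_odd' k with ⟨a, rfl | rfl⟩
  · exact heven (m - a) a (by omega)
  · exact H.functional_odd Λ (m := m) (fun j _ => H.raise_ne_zero j)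
      (fun j hj => hΛ _ (by omega)) a (by omega)

theorem form_even_eq_zero (H : IsSkewLadder κ A I B P) (m : ℕ) {φ : ℝ[X]}
    (hφ : φ.degree < (2 * m + 1 : ℕ)) : B (P (2 * m)) φ = 0 := by
  refine functional_eq_zero H.monic H.natDegree_eq _ ?_ hφ
  refine H.functional_vanish _ (fun k hk => ?_) (H.form_self _)
  rw [H.skew, H.adj, H.orth _ _ (by omega), mul_zero, neg_zero]

/-- In B(A P_{2m}, P_{2m}) = κ I(P_{2m}, P_{2m}) only the raised term of A P_{2m} survives, by
`form_even_eq_zero`. This is the source of γ_{2m} = 1/u_m. -/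
theorem form_even_odd (H : IsSkewLadder κ A I B P) (m : ℕ) :
    I (P (2 * m + 1)) (A (P (2 * m))) * B (P (2 * m)) (P (2 * m + 1)) =
      -(κ * I (P (2 * m)) (P (2 * m)) * I (P (2 * m + 1)) (P (2 * m + 1))) := by
  have h := H.adj (P (2 * m)) (P (2 * m))
  have key : I (P (2 * m + 1)) (A (P (2 * m))) / I (P (2 * m + 1)) (P (2 * m + 1)) *
      B (P (2 * m + 1)) (P (2 * m)) = κ * I (P (2 * m)) (P (2 * m)) := by
    rw [← h]
    cases m with
    | zero =>
      rw [mul_zero]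
      conv_rhs => rw [H.A_zero]
      rw [map_smul, LinearMap.smul_apply, smul_eq_mul]
    | succ m =>
      have h1 := H.form_even_eq_zero (m + 1)
        (H.degree_P_lt (k := 2 * m + 1) (m := 2 * (m + 1) + 1) (by omega))
      rw [H.skew, neg_eq_zero] at h1
      rw [show 2 * (m + 1) = 2 * m + 1 + 1 by ring] at h1 ⊢
      conv_rhs => rw [H.A_succ]
      rw [map_sub, LinearMap.sub_apply, map_smul, map_smul, LinearMap.smul_apply,
        LinearMap.smul_apply, h1, smul_zero, sub_zero, smul_eq_mul]
  rw [H.skew (P (2 * m + 1))] at key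
  rw [← key]
  have := H.norm_ne (2 * m + 1)
  field_simp

variable {Q : ℕ → ℝ[X]}

theorem even_eq (H : IsSkewLadder κ A I B P) (hQ : IsSkewOrtho B Q) (m : ℕ) :
    Q (2 * m) = P (2 * m) := by
  rw [← sub_eq_zero]
  refine hQ.eq_zero (n := m)
    (degree_sub_lt_of_monic H.monic H.natDegree_eq hQ.monic hQ.natDegree_eq _) fun k hk => ?_
  rw [map_sub, LinearMap.sub_apply, H.form_even_eq_zero m
    (degree_lt_of_natDegree_eq hQ.natDegree_eq (by omega)), sub_zero]
  rcases Nat.even_or_odd' k with ⟨a, rfl | rfl⟩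
  · exact hQ.even_even m a
  · exact hQ.even_odd m a (by omega)

theorem skewNorm_eq (H : IsSkewLadder κ A I B P) (hQ : IsSkewOrtho B Q) (m : ℕ) :
    B (Q (2 * m)) (Q (2 * m + 1)) = B (P (2 * m)) (P (2 * m + 1)) := by
  rw [H.even_eq hQ, ← sub_eq_zero, ← map_sub]
  exact H.form_even_eq_zero m
    (degree_sub_lt_of_monic H.monic H.natDegree_eq hQ.monic hQ.natDegree_eq _)

/-- The skew kernel as a polynomial in its first argument. -/
def skewKernel (B : ℝ[X] →ₗ[ℝ] ℝ[X] →ₗ[ℝ] ℝ) (Q : ℕ → ℝ[X]) (n : ℕ) (y : ℝ) : ℝ[X] :=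
  ∑ k ∈ Finset.range n, (1 / B (Q (2 * k)) (Q (2 * k + 1))) •
    ((Q (2 * k + 1)).eval y • Q (2 * k) - (Q (2 * k)).eval y • Q (2 * k + 1))

/-- For `c = Λ ∘ Q`, the polynomial of degree less than `2 * n` representing the functional `-Λ`
with respect to `B`. -/
def skewDual (B : ℝ[X] →ₗ[ℝ] ℝ[X] →ₗ[ℝ] ℝ) (Q : ℕ → ℝ[X]) (n : ℕ) (c : ℕ → ℝ) : ℝ[X] :=
  ∑ k ∈ Finset.range n, (1 / B (Q (2 * k)) (Q (2 * k + 1))) •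
    (c (2 * k) • Q (2 * k + 1) - c (2 * k + 1) • Q (2 * k))

theorem skewKernel_eq (n : ℕ) (y : ℝ) :
    skewKernel B Q n y = -skewDual B Q n fun k => (Q k).eval y := by
  rw [skewKernel, skewDual, ← Finset.sum_neg_distrib]
  refine Finset.sum_congr rfl fun k _ => ?_
  rw [← smul_neg, neg_sub]

theorem degree_skewDual_lt (hQ : IsSkewOrtho B Q) (n : ℕ) (c : ℕ → ℝ) :
    (skewDual B Q n c).degree < (2 * n : ℕ) := by
  rw [← mem_degreeLT]
  refine Submodule.sum_mem _ fun k hk => Submodule.smul_mem _ _ (Submodule.sub_mem _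
    (Submodule.smul_mem _ _ ?_) (Submodule.smul_mem _ _ ?_)) <;>
  · rw [mem_degreeLT]
    have := Finset.mem_range.1 hk
    exact degree_lt_of_natDegree_eq hQ.natDegree_eq (by omega)

theorem form_skewDual (hQ : IsSkewOrtho B Q) {n : ℕ} (c : ℕ → ℝ) {j : ℕ} (hj : j < 2 * n) :
    B (Q j) (skewDual B Q n c) = c j := by
  rw [skewDual, map_sum]
  rcases Nat.even_or_odd' j with ⟨a, rfl | rfl⟩
  · rw [Finset.sum_eq_single a]
    · rw [map_smul, map_sub, map_smul, map_smul, hQ.even_even]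
      have := hQ.ne_zero a
      simp [field]
    · intro b _ hb
      rw [map_smul, map_sub, map_smul, map_smul, hQ.even_even, hQ.even_odd a b hb.symm]
      simp
    · intro h
      exact absurd (Finset.mem_range.2 (by omega)) h
  · rw [Finset.sum_eq_single a]
    · rw [map_smul, map_sub, map_smul, map_smul, hQ.odd_odd, hQ.skew (Q (2 * a + 1))]
      have := hQ.ne_zero a
      simp [field]
    · intro b _ hb
      rw [map_smul, map_sub, map_smul, map_smul, hQ.odd_odd, hQ.odd_even hb.symm]
      simp
    · intro h
      exact absurd (Finset.mem_range.2 (by omega)) h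

theorem form_skewDual_functional (hQ : IsSkewOrtho B Q) {n : ℕ} (Λ : ℝ[X] →ₗ[ℝ] ℝ)
    {φ : ℝ[X]} (hφ : φ.degree < (2 * n : ℕ)) : B φ (skewDual B Q n fun k => Λ (Q k)) = Λ φ := by
  rw [← sub_eq_zero]
  refine functional_eq_zero hQ.monic hQ.natDegree_eq
    (B.flip (skewDual B Q n fun k => Λ (Q k)) - Λ) (fun k hk => ?_) hφ
  rw [LinearMap.sub_apply, LinearMap.flip_apply, form_skewDual hQ _ hk, sub_self]

theorem eq_of_form (hQ : IsSkewOrtho B Q) {n : ℕ} {φ ψ : ℝ[X]} (hφ : φ.degree < (2 * n : ℕ))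
    (hψ : ψ.degree < (2 * n : ℕ)) {R : ℕ → ℝ[X]} (hm : ∀ n, (R n).Monic)
    (hd : ∀ n, (R n).natDegree = n) (h : ∀ k < 2 * n, B (R k) φ = B (R k) ψ) : φ = ψ := by
  rw [← sub_eq_zero]
  refine hQ.eq_zero (lt_of_le_of_lt (degree_sub_le _ _) (max_lt hφ hψ)) fun k hk => ?_
  refine functional_eq_zero hm hd (B (φ - ψ)) (fun j hj => ?_)
    (degree_lt_of_natDegree_eq hQ.natDegree_eq hk)
  rw [hQ.skew, map_sub, h j hj, sub_self, neg_zero]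

/-- The representer of a functional annihilating the range of `A` is a multiple of an odd
orthogonal polynomial. -/
theorem skewDual_eq (H : IsSkewLadder κ A I B P) (hQ : IsSkewOrtho B Q) (m : ℕ)
    (Λ : ℝ[X] →ₗ[ℝ] ℝ) (hΛ : ∀ φ, Λ (A φ) = 0) :
    skewDual B Q (m + 1) (fun k => Λ (Q k)) =
      (Λ (Q (2 * m)) / B (Q (2 * m)) (Q (2 * m + 1))) • P (2 * m + 1) := by
  set G := skewDual B Q (m + 1) (fun k => Λ (Q k))
  have hdual : ∀ {φ : ℝ[X]}, φ.degree < (2 * (m + 1) : ℕ) → B φ G = Λ φ := fun hφ =>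
    form_skewDual_functional hQ Λ hφ
  set c := Λ (Q (2 * m)) / B (Q (2 * m)) (Q (2 * m + 1)) with hc
  have hu := hQ.ne_zero m
  let M : ℝ[X] →ₗ[ℝ] ℝ := B.flip (G - c • P (2 * m + 1))
  have hM : ∀ φ, M φ = B φ G - c * B φ (P (2 * m + 1)) := fun φ => by
    simp [M]
  have hMA : ∀ k < 2 * m + 1, M (A (P k)) = 0 := fun k hk => by
    rw [hM, hdual (H.degree_A_P_lt (by omega)), hΛ, H.adj, H.orth _ _ (by omega)]
    ring
  have hMtop : M (P (2 * m)) = 0 := by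
    rw [hM, hdual (H.degree_P_lt (by omega)), ← H.skewNorm_eq hQ, ← H.even_eq hQ, hc,
      div_mul_cancel₀ _ hu, sub_self]
  have hlow := H.functional_vanish M (fun k hk => hMA k (by omega)) hMtop
  -- The extra element A P_{2m} of the range carries the vanishing one step past
  -- `functional_vanish`, to P_{2m+1}.
  have hodd := H.functional_odd M (m := m + 1) (fun j _ => H.raise_ne_zero j)
    (fun j hj => hMA _ (by omega)) m (by omega)
  refine eq_of_form hQ (degree_skewDual_lt hQ _ _)
    (lt_of_le_of_lt (degree_smul_le _ _) (H.degree_P_lt (by omega))) H.monic H.natDegree_eq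
    fun k hk => ?_
  have hk0 : M (P k) = 0 := by
    rcases (show k ≤ 2 * m + 1 by omega).eq_or_lt with rfl | hk
    · exact hodd
    · exact hlow k hk
  rw [hM, sub_eq_zero] at hk0
  rw [hk0, map_smul, smul_eq_mul]

/-- The skew kernel in terms of the orthogonal polynomials. -/
theorem skewKernel_eq_ladder (H : IsSkewLadder κ A I B P) (hQ : IsSkewOrtho B Q) (m : ℕ)
    (y : ℝ) :
    skewKernel B Q (m + 1) y =
      κ⁻¹ • A (∑ l ∈ Finset.range (2 * m + 1), ((P l).eval y / I (P l) (P l)) • P l) +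
      ((P (2 * m + 1)).eval y / B (Q (2 * m)) (Q (2 * m + 1))) • P (2 * m) := by
  have hS : (∑ l ∈ Finset.range (2 * m + 1), ((P l).eval y / I (P l) (P l)) • P l).degree <
      (2 * m + 1 : ℕ) := by
    rw [← mem_degreeLT]
    refine Submodule.sum_mem _ fun k hk => Submodule.smul_mem _ _ ?_
    rw [mem_degreeLT]
    exact H.degree_P_lt (Finset.mem_range.1 hk)
  refine eq_of_form hQ (n := m + 1) ?_ ?_ H.monic H.natDegree_eq fun k hk => ?_
  · rw [skewKernel_eq, degree_neg]
    exact degree_skewDual_lt hQ _ _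
  · refine lt_of_le_of_lt (degree_add_le _ _) (max_lt
      (lt_of_le_of_lt (degree_smul_le _ _) (H.degree_lt _ _ hS))
      (lt_of_le_of_lt (degree_smul_le _ _) (H.degree_P_lt (by omega))))
  -- The A-term already reproduces evaluation on P_k for k ≤ 2m, where the P_{2m} term contributes
  -- nothing; the latter supplies exactly the missing value at k = 2m+1.
  · have h1 : B (P k) (skewKernel B Q (m + 1) y) = -(P k).eval y := by
      rw [skewKernel_eq, map_neg]
      exact congrArg Neg.neg (form_skewDual_functional hQ (leval y)
        (H.degree_P_lt (m := 2 * (m + 1)) hk))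
    rw [h1, map_add, map_smul, map_smul, H.skew _ (A _), H.adj, map_sum, LinearMap.sum_apply,
      H.skewNorm_eq hQ]
    have hu := hQ.ne_zero m
    rw [H.skewNorm_eq hQ] at hu
    rcases (show k ≤ 2 * m + 1 by omega).eq_or_lt with rfl | hk
    · rw [Finset.sum_eq_zero, H.skew (P (2 * m + 1))]
      · simp [field]
      · intro l hl
        have := Finset.mem_range.1 hl
        rw [map_smul, LinearMap.smul_apply, H.orth l (2 * m + 1) (by omega), smul_zero]
    · rw [Finset.sum_eq_single k, H.skew (P k), H.form_even_eq_zero m (H.degree_P_lt hk)]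
      · have h2 := H.norm_ne k
        have h3 := H.kappa_ne
        rw [map_smul, LinearMap.smul_apply, smul_eq_mul, smul_eq_mul]
        simp [field]
      · intro l _ hl
        rw [map_smul, LinearMap.smul_apply, H.orth _ _ hl, smul_zero]
      · intro h
        exact absurd (Finset.mem_range.2 hk) h

end IsSkewLadder

/-! ### Lattice sums, the kernel s and the bilinear forms -/

variable {q : ℝ} {ρ ω : ℝ → ℝ} {f g : ℝ[X]}

theorem pt_pos (hq0 : 0 < q) (i : ℤ) : 0 < pt q i := zpow_pos (Real.sqrt_pos.2 hq0) i

theorem pt_add_one (hq0 : 0 < q) (i : ℤ) : pt q (i + 1) = √q * pt q i := by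
  rw [pt, pt, zpow_add_one₀ (Real.sqrt_pos.2 hq0).ne', mul_comm]

theorem pt_sub_one (hq0 : 0 < q) (i : ℤ) : pt q (i - 1) = (√q)⁻¹ * pt q i := by
  rw [pt, pt, zpow_sub_one₀ (Real.sqrt_pos.2 hq0).ne', mul_comm]

theorem sqrt_lt_one (hq1 : q < 1) : √q < 1 := by
  rw [Real.sqrt_lt' one_pos]
  simpa using hq1

theorem tendsto_pt_atTop (hq1 : q < 1) : Tendsto (pt q) atTop (𝓝 0) := by
  have h := tendsto_pow_atTop_nhds_zero_of_lt_one (Real.sqrt_nonneg q) (sqrt_lt_one hq1)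
  have h2 : Tendsto Int.toNat atTop atTop :=
    tendsto_atTop_atTop.2 fun b => ⟨b, fun a ha => by omega⟩
  refine (h.comp h2).congr' ?_
  filter_upwards [eventually_ge_atTop 0] with i hi
  rw [Function.comp_apply, pt, ← zpow_natCast, Int.toNat_of_nonneg hi]

theorem tendsto_inv_pt_atBot (hq1 : q < 1) :
    Tendsto (fun i => (pt q i)⁻¹) atBot (𝓝 0) := by
  refine ((tendsto_pt_atTop hq1).comp tendsto_neg_atBot_atTop).congr fun i => ?_
  rw [Function.comp_apply, pt, pt, zpow_neg]

theorem tendsto_eval_pt (hq1 : q < 1) (φ : ℝ[X]) :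
    Tendsto (fun i => φ.eval (pt q i)) atTop (𝓝 (φ.eval 0)) :=
  (φ.continuous.tendsto 0).comp (tendsto_pt_atTop hq1)

theorem qInt_const_mul (a : ℝ) (φ : ℤ → ℝ) : qInt q (fun i => a * φ i) = a * qInt q φ := by
  rw [qInt, qInt, mul_left_comm a, ← tsum_mul_left (a := a)]
  simp only [mul_left_comm]

theorem qInt_add {φ ψ : ℤ → ℝ} (hφ : Summable fun i => pt q i * φ i)
    (hψ : Summable fun i => pt q i * ψ i) :
    qInt q (fun i => φ i + ψ i) = qInt q φ + qInt q ψ := by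
  simp only [qInt, mul_add, hφ.tsum_add hψ]

theorem HasMoments.summable_eval {w : ℝ → ℝ} (hw : HasMoments q w) (φ : ℝ[X]) :
    Summable fun i : ℤ => pt q i * (φ.eval (pt q i) * w (pt q i)) := by
  induction φ using Polynomial.induction_on' with
  | add φ ψ h1 h2 =>
    refine (h1.add h2).congr fun i => ?_
    rw [eval_add]
    ring
  | monomial k a =>
    refine ((hw k).mul_left a).congr fun i => ?_
    rw [eval_monomial]
    ring

theorem abs_sKer_le (i j : ℤ) : |sKer q i j| ≤ (1 + √q) ^ 2 := by
  rw [sKer, abs_mul, abs_of_nonneg (by positivity : (0 : ℝ) ≤ (1 + √q) ^ 2)]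
  refine mul_le_of_le_one_right (by positivity) ?_
  split_ifs <;> simp

theorem sKer_skew (i j : ℤ) : sKer q i j = -sKer q j i := by
  unfold sKer
  by_cases h1 : Odd i ∧ Even j ∧ j < i
  · have h2 : ¬(Odd j ∧ Even i ∧ i < j) := fun h => by omega
    have h3 : Even j ∧ Odd i ∧ j < i := ⟨h1.2.1, h1.1, h1.2.2⟩
    rw [if_pos h1, if_neg h2, if_pos h3]
    ring
  · have h3 : ¬(Even j ∧ Odd i ∧ j < i) := fun h => h1 ⟨h.2.1, h.1, h.2.2⟩
    rw [if_neg h1, if_neg h3]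
    by_cases h2 : Odd j ∧ Even i ∧ i < j
    · rw [if_pos h2, if_pos ⟨h2.2.1, h2.1, h2.2.2⟩]
      ring
    · rw [if_neg h2, if_neg fun h => h2 ⟨h.2.1, h.1, h.2.2⟩]
      ring

/-- The kernel is a Green's function for the two-step difference in its second variable. -/
theorem sKer_sub (i j : ℤ) :
    sKer q i (j + 1) - sKer q i (j - 1) = if i = j then -(1 + √q) ^ 2 else 0 := by
  unfold sKer
  rcases Int.even_or_odd i with hi | hi <;> rcases Int.even_or_odd j with hj | hj
  all_goals
    have hi' := hi
    have hj' := hj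
    first
      | rw [← Int.not_odd_iff_even] at hi'
      | rw [← Int.not_even_iff_odd] at hi'
    first
      | rw [← Int.not_odd_iff_even] at hj'
      | rw [← Int.not_even_iff_odd] at hj'
  · have h1 : Odd (j + 1) := hj.add_one
    have h2 : Odd (j - 1) := hj.sub_odd odd_one
    simp only [hi, hi', h1, h2, false_and, true_and, if_false]
    split_ifs <;> grind
  · have h1 : ¬Odd (j + 1) := by rw [Int.not_odd_iff_even]; exact hj.add_one
    have h2 : ¬Odd (j - 1) := by rw [Int.not_odd_iff_even]; exact hj.sub_odd odd_one
    have h3 : i ≠ j := by rintro rfl; exact hj' hi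
    simp [hi', h1, h2, h3]
  · have h1 : ¬Even (j + 1) := by rw [Int.not_even_iff_odd]; exact hj.add_one
    have h2 : ¬Even (j - 1) := by rw [Int.not_even_iff_odd]; exact hj.sub_odd odd_one
    have h3 : i ≠ j := by rintro rfl; exact hj' hi
    simp [hi', h1, h2, h3]
  · have h1 : Even (j + 1) := hj.add_one
    have h2 : Even (j - 1) := hj.sub_odd odd_one
    simp only [hi, hi', h1, h2, false_and, true_and, if_false]
    split_ifs <;> grind

theorem summable_sKer (hω : HasMoments q ω) (φ : ℝ[X]) (j : ℤ) :
    Summable fun i : ℤ => pt q i * (sKer q i j * φ.eval (pt q i) * ω (pt q i)) := by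
  refine Summable.of_norm_bounded ((hω.summable_eval φ).norm.mul_left ((1 + √q) ^ 2))
    fun i => ?_
  rw [show pt q i * (sKer q i j * φ.eval (pt q i) * ω (pt q i)) =
    sKer q i j * (pt q i * (φ.eval (pt q i) * ω (pt q i))) by ring, norm_mul]
  exact mul_le_mul_of_nonneg_right (abs_sKer_le i j) (norm_nonneg _)

/-- `sOp` as a linear map on polynomials. -/
def sLin (hω : HasMoments q ω) : ℝ[X] →ₗ[ℝ] (ℤ → ℝ) where
  toFun φ := sOp q ω fun z => φ.eval z
  map_add' φ ψ := by
    ext j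
    simp only [sOp, Pi.add_apply]
    rw [← qInt_add (summable_sKer hω φ j) (summable_sKer hω ψ j)]
    congr 1
    ext i
    rw [eval_add]
    ring
  map_smul' a φ := by
    ext j
    simp only [sOp, Pi.smul_apply, RingHom.id_apply, smul_eq_mul]
    rw [← qInt_const_mul]
    congr 1
    ext i
    rw [eval_smul, smul_eq_mul]
    ring

theorem sLin_apply (hω : HasMoments q ω) (φ : ℝ[X]) (j : ℤ) :
    sLin hω φ j = sOp q ω (fun z => φ.eval z) j := rfl

theorem sLin_sub (hω : HasMoments q ω) (φ : ℝ[X]) (j : ℤ) :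
    sLin hω φ (j + 1) - sLin hω φ (j - 1) =
      -(1 + √q) ^ 2 * ((1 - √q) * (pt q j * (φ.eval (pt q j) * ω (pt q j)))) := by
  simp only [sLin_apply, sOp, qInt]
  rw [← mul_sub, ← (summable_sKer hω φ (j + 1)).tsum_sub (summable_sKer hω φ (j - 1)),
    tsum_eq_single j]
  · rw [← mul_sub, ← sub_mul, ← sub_mul, sKer_sub, if_pos rfl]
    ring
  · intro i hi
    rw [← mul_sub, ← sub_mul, ← sub_mul, sKer_sub, if_neg hi]
    ring

/-- Limits of `sLin` along a sequence on which the kernel is eventually constant in its second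
argument. -/
theorem tendsto_sLin (hω : HasMoments q ω) (φ : ℝ[X]) {l : Filter ℤ} {e : ℤ → ℤ} {k : ℤ → ℝ}
    (hk : ∀ i, ∀ᶠ m in l, sKer q i (e m) = k i) :
    Tendsto (fun m => sLin hω φ (e m)) l
      (𝓝 (qInt q fun i => k i * φ.eval (pt q i) * ω (pt q i))) := by
  simp only [sLin_apply, sOp, qInt]
  refine Tendsto.const_mul _ (tendsto_tsum_of_dominated_convergence
    ((hω.summable_eval φ).norm.mul_left ((1 + √q) ^ 2)) (fun i => ?_)
    (Eventually.of_forall fun m i => ?_))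
  · refine tendsto_const_nhds.congr' ?_
    filter_upwards [hk i] with m hm
    rw [hm]
  · rw [show pt q i * (sKer q i (e m) * φ.eval (pt q i) * ω (pt q i)) =
      sKer q i (e m) * (pt q i * (φ.eval (pt q i) * ω (pt q i))) by ring, norm_mul]
    exact mul_le_mul_of_nonneg_right (abs_sKer_le i _) (norm_nonneg _)

theorem tendsto_sLin_even_atTop (hω : HasMoments q ω) (φ : ℝ[X]) :
    Tendsto (fun m : ℤ => sLin hω φ (2 * m)) atTop (𝓝 0) := by
  have h := tendsto_sLin hω φ (l := atTop) (e := fun m => 2 * m) (k := fun _ => 0) fun i => by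
    filter_upwards [eventually_ge_atTop |i|] with m hm
    have h1 := le_abs_self i
    have h2 := abs_nonneg i
    have h3 : ¬Odd (2 * m) := by simp
    rw [sKer, if_neg (fun h => by omega), if_neg (fun h => h3 h.2.1), mul_zero]
  simpa [qInt] using h

theorem tendsto_sLin_odd_atBot (hω : HasMoments q ω) (φ : ℝ[X]) :
    Tendsto (fun m : ℤ => sLin hω φ (2 * m + 1)) atBot (𝓝 0) := by
  have h := tendsto_sLin hω φ (l := atBot) (e := fun m => 2 * m + 1) (k := fun _ => 0)
    fun i => by
      filter_upwards [eventually_le_atBot (-|i| - 1)] with m hm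
      have h1 := neg_abs_le i
      have h2 := abs_nonneg i
      have h3 : ¬Even (2 * m + 1) := by simp
      rw [sKer, if_neg (fun h => h3 h.2.1), if_neg (fun h => by omega), mul_zero]
  simpa [qInt] using h

/-- The functional `φ ↦ ∫ F φ ω`. -/
def betaLin (hω : HasMoments q ω) : ℝ[X] →ₗ[ℝ] ℝ where
  toFun φ := qInt q fun i => F q i * φ.eval (pt q i) * ω (pt q i)
  map_add' φ ψ := by
    have hs : ∀ φ : ℝ[X], Summable fun i : ℤ =>
        pt q i * (F q i * φ.eval (pt q i) * ω (pt q i)) := fun φ => by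
      refine Summable.of_norm_bounded ((hω.summable_eval φ).norm.mul_left (1 + √q)) fun i => ?_
      rw [show pt q i * (F q i * φ.eval (pt q i) * ω (pt q i)) =
        F q i * (pt q i * (φ.eval (pt q i) * ω (pt q i))) by ring, norm_mul]
      refine mul_le_mul_of_nonneg_right ?_ (norm_nonneg _)
      have h0 : (0 : ℝ) ≤ 1 + √q := by positivity
      rw [F]
      split_ifs
      · rw [Real.norm_of_nonneg h0]
      · simpa using h0
    rw [← qInt_add (hs φ) (hs ψ)]
    congr 1
    ext i
    rw [eval_add]
    ring
  map_smul' a φ := by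
    rw [RingHom.id_apply, smul_eq_mul, ← qInt_const_mul]
    congr 1
    ext i
    rw [eval_smul, smul_eq_mul]
    ring

/-- F is the boundary value of the kernel: for fixed i and large odd j, s(i,j) = -(1+√q)F(i). -/
theorem tendsto_sLin_odd_atTop (hω : HasMoments q ω) (φ : ℝ[X]) :
    Tendsto (fun m : ℤ => sLin hω φ (2 * m + 1)) atTop (𝓝 (-(1 + √q) * betaLin hω φ)) := by
  have h := tendsto_sLin hω φ (l := atTop) (e := fun m => 2 * m + 1)
    (k := fun i => -(1 + √q) * F q i) fun i => by
      filter_upwards [eventually_ge_atTop |i|] with m hm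
      have h1 := le_abs_self i
      have h2 := abs_nonneg i
      have h3 : ¬Even (2 * m + 1) := by simp
      rw [sKer, if_neg (fun h => h3 h.2.1), F]
      by_cases hi : Even i
      · rw [if_pos ⟨hi, by simp, by omega⟩, if_pos hi]
        ring
      · rw [if_neg fun h => hi h.1, if_neg hi]
        ring
  convert h using 2
  simp only [betaLin, LinearMap.coe_mk, AddHom.coe_mk]
  rw [← qInt_const_mul]
  congr 1
  ext i
  ring

theorem exists_sLin_bound (hω : HasMoments q ω) (φ : ℝ[X]) :
    ∃ M, ∀ j, |sLin hω φ j| ≤ M := by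
  refine ⟨|1 - √q| * ∑' i, (1 + √q) ^ 2 * ‖pt q i * (φ.eval (pt q i) * ω (pt q i))‖,
    fun j => ?_⟩
  rw [sLin_apply, sOp, qInt, abs_mul]
  refine mul_le_mul_of_nonneg_left ?_ (abs_nonneg _)
  rw [← Real.norm_eq_abs]
  refine tsum_of_norm_bounded ((hω.summable_eval φ).norm.mul_left ((1 + √q) ^ 2)).hasSum
    fun i => ?_
  rw [show pt q i * (sKer q i j * φ.eval (pt q i) * ω (pt q i)) =
    sKer q i j * (pt q i * (φ.eval (pt q i) * ω (pt q i))) by ring, norm_mul]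
  exact mul_le_mul_of_nonneg_right (abs_sKer_le i j) (norm_nonneg _)

theorem skew1_eq (hω : HasMoments q ω) (φ ψ : ℝ[X]) :
    skew1 q ω (fun x => φ.eval x) (fun x => ψ.eval x) =
      qInt q fun j => ψ.eval (pt q j) * ω (pt q j) * sLin hω φ j := by
  rw [skew1]
  congr 1
  ext j
  rw [sLin_apply, sOp, ← qInt_const_mul]
  congr 1
  ext i
  ring

theorem summable_skew1 (hω : HasMoments q ω) (φ ψ : ℝ[X]) :
    Summable fun j => pt q j * (ψ.eval (pt q j) * ω (pt q j) * sLin hω φ j) := by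
  obtain ⟨M, hM⟩ := exists_sLin_bound hω φ
  refine Summable.of_norm_bounded ((hω.summable_eval ψ).norm.mul_left M) fun j => ?_
  rw [← mul_assoc, norm_mul, mul_comm]
  exact mul_le_mul_of_nonneg_right (hM j) (norm_nonneg _)

/-- `skew1` as a bilinear form on polynomials. -/
def skewForm (hω : HasMoments q ω) : ℝ[X] →ₗ[ℝ] ℝ[X] →ₗ[ℝ] ℝ :=
  LinearMap.mk₂ ℝ (fun φ ψ => skew1 q ω (fun x => φ.eval x) (fun x => ψ.eval x))
    (fun φ φ' ψ => by
      simp only [skew1_eq hω]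
      rw [← qInt_add (summable_skew1 hω φ ψ) (summable_skew1 hω φ' ψ)]
      congr 1
      ext i
      rw [map_add, Pi.add_apply]
      ring)
    (fun a φ ψ => by
      simp only [skew1_eq hω, smul_eq_mul]
      rw [← qInt_const_mul]
      congr 1
      ext i
      rw [map_smul, Pi.smul_apply, smul_eq_mul]
      ring)
    (fun φ ψ ψ' => by
      simp only [skew1_eq hω]
      rw [← qInt_add (summable_skew1 hω φ ψ) (summable_skew1 hω φ ψ')]
      congr 1
      ext i
      rw [eval_add]
      ring)
    (fun a φ ψ => by
      simp only [skew1_eq hω, smul_eq_mul]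
      rw [← qInt_const_mul]
      congr 1
      ext i
      rw [eval_smul, smul_eq_mul]
      ring)

theorem skewForm_apply (hω : HasMoments q ω) (φ ψ : ℝ[X]) :
    skewForm hω φ ψ = skew1 q ω (fun x => φ.eval x) (fun x => ψ.eval x) := rfl

theorem skewForm_eq (hω : HasMoments q ω) (φ ψ : ℝ[X]) :
    skewForm hω φ ψ = qInt q fun j => ψ.eval (pt q j) * ω (pt q j) * sLin hω φ j :=
  skew1_eq hω φ ψ

/-- Boundedness of the kernel and absolute convergence of the moments justify exchanging the two
sums. -/
theorem skewForm_skew (hω : HasMoments q ω) (φ ψ : ℝ[X]) :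
    skewForm hω φ ψ = -skewForm hω ψ φ := by
  let a : ℝ[X] → ℤ → ℝ := fun φ i => pt q i * (φ.eval (pt q i) * ω (pt q i))
  have hskew : ∀ φ ψ : ℝ[X], skewForm hω φ ψ =
      (1 - √q) ^ 2 * ∑' j, ∑' i, a φ i * a ψ j * sKer q i j := fun φ ψ => by
    rw [skewForm_apply, skew1, qInt, pow_two, mul_assoc]
    congr 1
    rw [← tsum_mul_left]
    congr 1
    ext j
    rw [qInt, mul_left_comm]
    congr 1
    rw [← tsum_mul_left]
    congr 1
    ext i
    simp only [a]
    ring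
  have hsum : Summable (Function.uncurry fun j i => a φ i * a ψ j * sKer q i j) := by
    refine Summable.of_norm_bounded (((hω.summable_eval ψ).norm.mul_of_nonneg
      (hω.summable_eval φ).norm (fun _ => norm_nonneg _)
      (fun _ => norm_nonneg _)).mul_left ((1 + √q) ^ 2)) fun x => ?_
    rw [Function.uncurry_def, norm_mul, norm_mul, mul_comm, mul_comm ‖a φ x.2‖]
    exact mul_le_mul_of_nonneg_right (abs_sKer_le _ _) (by positivity)
  rw [hskew φ, hskew ψ, ← hsum.tsum_comm, ← mul_neg, ← tsum_neg]
  congr 2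
  ext i
  rw [← tsum_neg]
  congr 1
  ext j
  rw [sKer_skew]
  ring

/-- `inner2` as a bilinear form on polynomials. -/
def innerForm (hρ : HasMoments q ρ) : ℝ[X] →ₗ[ℝ] ℝ[X] →ₗ[ℝ] ℝ :=
  LinearMap.mk₂ ℝ (fun φ ψ => inner2 q ρ (fun x => φ.eval x) (fun x => ψ.eval x))
    (fun φ φ' ψ => by
      simp only [inner2]
      rw [← qInt_add]
      · congr 1
        ext i
        rw [eval_add]
        ring
      · simpa only [eval_mul] using hρ.summable_eval (φ * ψ)
      · simpa only [eval_mul] using hρ.summable_eval (φ' * ψ))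
    (fun a φ ψ => by
      simp only [inner2, smul_eq_mul]
      rw [← qInt_const_mul]
      congr 1
      ext i
      rw [eval_smul, smul_eq_mul]
      ring)
    (fun φ ψ ψ' => by
      simp only [inner2]
      rw [← qInt_add]
      · congr 1
        ext i
        rw [eval_add]
        ring
      · simpa only [eval_mul] using hρ.summable_eval (φ * ψ)
      · simpa only [eval_mul] using hρ.summable_eval (φ * ψ'))
    (fun a φ ψ => by
      simp only [inner2, smul_eq_mul]
      rw [← qInt_const_mul]
      congr 1
      ext i
      rw [eval_smul, smul_eq_mul]
      ring)

theorem innerForm_apply (hρ : HasMoments q ρ) (φ ψ : ℝ[X]) :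
    innerForm hρ φ ψ = inner2 q ρ (fun x => φ.eval x) (fun x => ψ.eval x) := rfl

/-! ### The difference operator on polynomials -/

/-- The operator `opA` on polynomials. -/
def polyA (q : ℝ) (f g : ℝ[X]) : ℝ[X] →ₗ[ℝ] ℝ[X] where
  toFun φ := g * φ.comp (C √q * X) +
    f * (C (1 - √q)⁻¹ * (φ.comp (C (√q)⁻¹ * X) - φ.comp (C √q * X)).divX)
  map_add' φ ψ := by
    simp only [add_comp, add_sub_add_comm, divX_add]
    ring
  map_smul' a φ := by
    simp only [RingHom.id_apply, smul_eq_C_mul, divX_C_mul, C_mul_comp, ← mul_sub]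
    ring

theorem mul_eval_divX_sub (φ : ℝ[X]) (a b x : ℝ) :
    x * ((φ.comp (C a * X) - φ.comp (C b * X)).divX).eval x =
      φ.eval (a * x) - φ.eval (b * x) := by
  have h := congrArg (eval x) (X_mul_divX_add (φ.comp (C a * X) - φ.comp (C b * X)))
  have h0 : (φ.comp (C a * X) - φ.comp (C b * X)).coeff 0 = 0 := by
    simp [coeff_zero_eq_eval_zero]
  rw [h0, C_0, add_zero] at h
  simpa using h

theorem mul_eval_polyA (hq1 : q < 1) (φ : ℝ[X]) (x : ℝ) :
    (1 - √q) * x * (polyA q f g φ).eval x = f.eval x * φ.eval ((√q)⁻¹ * x) -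
      (f.eval x - (1 - √q) * x * g.eval x) * φ.eval (√q * x) := by
  have h1 : 1 - √q ≠ 0 := (sub_pos.2 (sqrt_lt_one hq1)).ne'
  have h := mul_eval_divX_sub φ (√q)⁻¹ √q x
  simp only [polyA, LinearMap.coe_mk, AddHom.coe_mk, eval_add, eval_mul, eval_comp, eval_C,
    eval_X]
  field_simp at h ⊢
  linear_combination f.eval x * h

/-- The φ(x) terms of the two difference quotients cancel, leaving φ(x/√q) - φ(√q x), which has no
constant term and is divisible by x. -/
theorem opA_eq_eval (hq0 : 0 < q) (hq1 : q < 1) (φ : ℝ[X]) {x : ℝ} (hx : x ≠ 0) :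
    opA q f g (fun x => φ.eval x) x = (polyA q f g φ).eval x := by
  have ht : √q ≠ 0 := (Real.sqrt_pos.2 hq0).ne'
  have h1 : 1 - √q ≠ 0 := (sub_pos.2 (sqrt_lt_one hq1)).ne'
  have h2 : 1 - (√q)⁻¹ ≠ 0 := by
    rw [sub_ne_zero, ne_comm, Ne, inv_eq_one]
    exact (sqrt_lt_one hq1).ne
  apply mul_left_cancel₀ (mul_ne_zero h1 hx)
  rw [mul_eval_polyA hq1, opA, qDiff, qDiff]
  have h4 : (√q)⁻¹ * f.eval x *
      ((φ.eval x - φ.eval ((√q)⁻¹ * x)) / ((1 - (√q)⁻¹) * x)) =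
      -(f.eval x * ((φ.eval x - φ.eval ((√q)⁻¹ * x)) / ((1 - √q) * x))) := by
    rw [mul_div_assoc', mul_div_assoc', ← neg_div, div_eq_div_iff (mul_ne_zero h2 hx)
      (mul_ne_zero h1 hx)]
    have h5 : (√q)⁻¹ * (1 - √q) = -(1 - (√q)⁻¹) := by
      field_simp
      ring
    linear_combination f.eval x * (φ.eval x - φ.eval ((√q)⁻¹ * x)) * x * h5
  rw [h4]
  field_simp
  ring

theorem degree_polyA_lt (hf : f.natDegree ≤ 2) (hg : g.natDegree ≤ 1) (φ : ℝ[X]) (m : ℕ)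
    (hφ : φ.degree < m) : (polyA q f g φ).degree < (m + 1 : ℕ) := by
  have hcomp : ∀ a : ℝ, (φ.comp (C a * X)).natDegree ≤ φ.natDegree := fun a => by
    refine natDegree_comp_le.trans ?_
    calc φ.natDegree * (C a * X : ℝ[X]).natDegree ≤ φ.natDegree * 1 :=
          Nat.mul_le_mul_left _ ((natDegree_C_mul_le _ _).trans natDegree_X_le)
      _ = _ := mul_one _
  -- For constants the truncated degree of `divX` would bound the f-term only by 2; there the
  -- difference itself is zero.
  by_cases h0 : φ.natDegree = 0
  · rw [natDegree_eq_zero] at h0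
    obtain ⟨a, rfl⟩ := h0
    by_cases ha : a = 0
    · subst ha
      simp [polyA]
    · rw [degree_C ha] at hφ
      have hm : 0 < m := by exact_mod_cast hφ
      simp only [polyA, LinearMap.coe_mk, AddHom.coe_mk, C_comp, sub_self, divX_zero, mul_zero,
        add_zero]
      refine lt_of_le_of_lt degree_le_natDegree ?_
      have : (g * C a).natDegree ≤ 1 := (natDegree_mul_C_le _ _).trans hg
      exact_mod_cast (by omega : (g * C a).natDegree < m + 1)
  · have hφ0 : φ ≠ 0 := by
      rintro rfl
      simp at h0
    have hd : φ.natDegree < m := (natDegree_lt_iff_degree_lt hφ0).2 hφ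
    refine lt_of_le_of_lt degree_le_natDegree ?_
    have h1 : (g * φ.comp (C √q * X)).natDegree ≤ m := by
      refine natDegree_mul_le.trans ?_
      have := hcomp √q
      omega
    have h2 : (f * (C (1 - √q)⁻¹ *
        (φ.comp (C (√q)⁻¹ * X) - φ.comp (C √q * X)).divX)).natDegree ≤ m := by
      refine natDegree_mul_le.trans ?_
      have h3 := natDegree_C_mul_le (1 - √q)⁻¹
        (φ.comp (C (√q)⁻¹ * X) - φ.comp (C √q * X)).divX
      rw [natDegree_divX_eq_natDegree_tsub_one] at h3
      have h4 := natDegree_sub_le (φ.comp (C (√q)⁻¹ * X)) (φ.comp (C √q * X))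
      have h5 := max_le (hcomp (√q)⁻¹) (hcomp √q)
      omega
    have h3 := (natDegree_add_le _ _).trans (max_le h1 h2)
    exact_mod_cast Nat.lt_succ_of_le h3

/-! ### The identity s(Aφ) = κ(ρ/ω)φ -/

theorem weight_succ_ne_zero (hρ : IsQClassical q ρ f g) (hω : IsSkewWeight q ρ f ω) {j : ℤ}
    (hj : ω (pt q j) ≠ 0) : ω (pt q (j + 1)) ≠ 0 := by
  rw [hω.support_iff] at hj ⊢
  rcases hρ.support with h | ⟨N, h⟩
  · exact h _
  · rw [h] at hj ⊢
    omega

/-- Here b ∈ q^ℤ matters: a bounded support begins at an even index, so an even point outside it has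
both odd neighbours outside. -/
theorem weight_neighbors_eq_zero (hρ : IsQClassical q ρ f g) (hω : IsSkewWeight q ρ f ω) {m : ℤ}
    (hm : ω (pt q (2 * m)) = 0) : ω (pt q (2 * m - 1)) = 0 ∧ ω (pt q (2 * m + 1)) = 0 := by
  have hiff : ∀ i, ω (pt q i) = 0 ↔ ρ (pt q i) = 0 := fun i => not_iff_not.1 (hω.support_iff i)
  rw [hiff] at hm
  rw [hiff, hiff]
  rcases hρ.support with h | ⟨N, h⟩
  · exact absurd hm (h _)
  · have h' : ∀ i, ρ (pt q i) = 0 ↔ i < 2 * N := fun i => by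
      rw [← not_iff_not, ← Ne, h, not_lt]
    rw [h'] at hm
    rw [h', h']
    omega

theorem ratio_mul (hω : IsSkewWeight q ρ f ω) (j : ℤ) :
    ρ (pt q j) / ω (pt q j) * ω (pt q j) = ρ (pt q j) := by
  by_cases h : ω (pt q j) = 0
  · rw [h, mul_zero, eq_comm]
    by_contra h'
    exact (hω.support_iff j).2 h' h
  · exact div_mul_cancel₀ _ h

theorem ratio_eq (hq0 : 0 < q) (hω : IsSkewWeight q ρ f ω) {j : ℤ} (hj : ω (pt q j) ≠ 0) :
    ρ (pt q j) / ω (pt q j) = ω (pt q (j + 1)) * f.eval (pt q (j + 1)) := by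
  rw [div_eq_iff hj, ← hω.rel j, pt_add_one hq0]
  ring

theorem f_mul_weight (hq0 : 0 < q) (hρ : IsQClassical q ρ f g) (hω : IsSkewWeight q ρ f ω) (j : ℤ) :
    f.eval (pt q j) * ρ (pt q j) =
      ρ (pt q (j - 1)) / ω (pt q (j - 1)) * (ρ (pt q j) / ω (pt q j)) := by
  by_cases h : ω (pt q (j - 1)) = 0
  · have h1 : ρ (pt q (j - 1)) = 0 := by
      by_contra h'
      exact (hω.support_iff _).2 h' h
    have h2 := hρ.pearson (j - 1)
    rw [← pt_add_one hq0, sub_add_cancel, h1, mul_zero] at h2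
    rw [h2, h1, zero_div, zero_mul]
  · have h1 := ratio_eq hq0 hω h
    rw [sub_add_cancel] at h1
    rw [h1]
    nth_rw 1 [← ratio_mul hω j]
    ring

/-- With r = ρ/ω, `f_mul_weight` and the Pearson equation turn both coefficients in
`mul_eval_polyA`, after multiplication by ρ, into r(x) times the value of r at a neighbour; then
r(x) is cancelled. -/
theorem ratio_step (hq0 : 0 < q) (hq1 : q < 1) (hρ : IsQClassical q ρ f g)
    (hω : IsSkewWeight q ρ f ω) (φ : ℝ[X]) {j : ℤ} (hj : ω (pt q j) ≠ 0) :
    (1 - √q) * (pt q j * ((polyA q f g φ).eval (pt q j) * ω (pt q j))) =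
      ρ (pt q (j - 1)) / ω (pt q (j - 1)) * φ.eval (pt q (j - 1)) -
        ρ (pt q (j + 1)) / ω (pt q (j + 1)) * φ.eval (pt q (j + 1)) := by
  have hr : ρ (pt q j) / ω (pt q j) ≠ 0 := div_ne_zero ((hω.support_iff j).1 hj) hj
  have h1 := f_mul_weight hq0 hρ hω j
  have h2 := f_mul_weight hq0 hρ hω (j + 1)
  rw [add_sub_cancel_right] at h2
  have h3 := hρ.pearson j
  rw [← pt_add_one hq0, h2] at h3
  have h4 := mul_eval_polyA (f := f) (g := g) hq1 φ (pt q j)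
  rw [← pt_sub_one hq0, ← pt_add_one hq0] at h4
  have h5 := ratio_mul hω j
  apply mul_left_cancel₀ hr
  linear_combination ρ (pt q j) * h4 + φ.eval (pt q (j - 1)) * h1 + φ.eval (pt q (j + 1)) * h3 +
    (1 - √q) * pt q j * (polyA q f g φ).eval (pt q j) * h5

/-- The difference `s 𝒜 φ - (1 + √q)² (ρ / ω) φ`. -/
def defect (hω : IsSkewWeight q ρ f ω) (g φ : ℝ[X]) (j : ℤ) : ℝ :=
  sLin hω.moments (polyA q f g φ) j -
    (1 + √q) ^ 2 * (ρ (pt q j) / ω (pt q j) * φ.eval (pt q j))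

theorem defect_step (hq0 : 0 < q) (hq1 : q < 1) (hρ : IsQClassical q ρ f g)
    (hω : IsSkewWeight q ρ f ω) (φ : ℝ[X]) {j : ℤ} (hj : ω (pt q j) ≠ 0) :
    defect hω g φ (j + 1) = defect hω g φ (j - 1) := by
  have h1 := sLin_sub hω.moments (polyA q f g φ) j
  rw [ratio_step hq0 hq1 hρ hω φ hj] at h1
  rw [defect, defect]
  linear_combination h1

/-- Off the support both ratios are 0 by division by zero and s(Aφ) does not jump, so the odd class
can be followed to infinity even for bounded support. -/
theorem defect_step_even (hq0 : 0 < q) (hq1 : q < 1) (hρ : IsQClassical q ρ f g)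
    (hω : IsSkewWeight q ρ f ω) (φ : ℝ[X]) (m : ℤ) :
    defect hω g φ (2 * m + 1) = defect hω g φ (2 * m - 1) := by
  by_cases hm : ω (pt q (2 * m)) = 0
  · obtain ⟨h1, h2⟩ := weight_neighbors_eq_zero hρ hω hm
    have h3 := sLin_sub hω.moments (polyA q f g φ) (2 * m)
    rw [hm] at h3
    rw [defect, defect, h1, h2]
    linear_combination h3
  · exact defect_step hq0 hq1 hρ hω φ hm

theorem defect_odd_eq (hq0 : 0 < q) (hq1 : q < 1) (hρ : IsQClassical q ρ f g)
    (hω : IsSkewWeight q ρ f ω) (φ : ℝ[X]) (m : ℤ) :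
    defect hω g φ (2 * m + 1) = defect hω g φ 1 := by
  have hstep : ∀ m : ℤ, defect hω g φ (2 * (m + 1) + 1) = defect hω g φ (2 * m + 1) := fun m => by
    rw [defect_step_even hq0 hq1 hρ hω]
    congr 1
    ring
  induction m using Int.induction_on with
  | zero => rfl
  | succ i ih => rw [hstep, ih]
  | pred i ih =>
    have h := hstep (-(i : ℤ) - 1)
    rw [sub_add_cancel] at h
    rw [← h, ih]

/-- No decay at infinity is assumed. Constancy of the defect makes (ρ/ω)ψ converge for every
polynomial ψ; taking ψ = xφ and dividing by x forces the limit 0. -/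
theorem tendsto_ratio_odd_atBot (hq0 : 0 < q) (hq1 : q < 1) (hρ : IsQClassical q ρ f g)
    (hω : IsSkewWeight q ρ f ω) (φ : ℝ[X]) :
    Tendsto (fun m : ℤ => ρ (pt q (2 * m + 1)) / ω (pt q (2 * m + 1)) *
      φ.eval (pt q (2 * m + 1))) atBot (𝓝 0) := by
  have hκ : (1 + √q) ^ 2 ≠ 0 := by positivity
  have hlim : ∀ ψ : ℝ[X], Tendsto (fun m : ℤ => ρ (pt q (2 * m + 1)) / ω (pt q (2 * m + 1)) *
      ψ.eval (pt q (2 * m + 1))) atBot (𝓝 (((1 + √q) ^ 2)⁻¹ * (0 - defect hω g ψ 1))) :=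
    fun ψ => by
      refine (((tendsto_sLin_odd_atBot hω.moments (polyA q f g ψ)).sub_const
        (defect hω g ψ 1)).const_mul _).congr fun m => ?_
      rw [← defect_odd_eq hq0 hq1 hρ hω ψ m, defect]
      field_simp
      ring
  have hodd : Tendsto (fun m : ℤ => 2 * m + 1) atBot atBot :=
    tendsto_atBot_atBot.2 fun b => ⟨-|b| - 1, fun a ha => by
      have := neg_abs_le b
      have := abs_nonneg b
      omega⟩
  have h := (hlim (φ * X)).mul ((tendsto_inv_pt_atBot hq1).comp hodd)
  rw [mul_zero] at h
  refine h.congr fun m => ?_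
  have := (pt_pos hq0 (2 * m + 1)).ne'
  rw [Function.comp_apply, eval_mul, eval_X]
  field_simp

theorem defect_odd (hq0 : 0 < q) (hq1 : q < 1) (hρ : IsQClassical q ρ f g)
    (hω : IsSkewWeight q ρ f ω) (φ : ℝ[X]) (m : ℤ) : defect hω g φ (2 * m + 1) = 0 := by
  rw [defect_odd_eq hq0 hq1 hρ hω]
  have h := (tendsto_sLin_odd_atBot hω.moments (polyA q f g φ)).sub
    ((tendsto_ratio_odd_atBot hq0 hq1 hρ hω φ).const_mul ((1 + √q) ^ 2))
  rw [mul_zero, sub_zero] at h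
  refine tendsto_nhds_unique (tendsto_const_nhds.congr fun m => ?_) h
  exact (defect_odd_eq hq0 hq1 hρ hω φ m).symm

theorem tendsto_ratio_atTop (hq1 : q < 1)
    (hlim : Tendsto (fun i : ℤ => ρ (pt q i) / ω (pt q i)) atTop (𝓝 0)) (φ : ℝ[X]) :
    Tendsto (fun i : ℤ => ρ (pt q i) / ω (pt q i) * φ.eval (pt q i)) atTop (𝓝 0) := by
  simpa using hlim.mul (tendsto_eval_pt hq1 φ)

theorem tendsto_two_mul_add (a : ℤ) : Tendsto (fun m : ℤ => 2 * m + a) atTop atTop :=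
  tendsto_atTop_atTop.2 fun b => ⟨|b| + |a|, fun m hm => by
    have := le_abs_self b
    have := neg_abs_le a
    have := abs_nonneg a
    have := abs_nonneg b
    omega⟩

/-- The even class is followed towards x = 0, which never leaves the support; there `hlim` and the
decay of s at even points make the defect tend to 0. -/
theorem defect_even (hq0 : 0 < q) (hq1 : q < 1) (hρ : IsQClassical q ρ f g)
    (hω : IsSkewWeight q ρ f ω)
    (hlim : Tendsto (fun i : ℤ => ρ (pt q i) / ω (pt q i)) atTop (𝓝 0)) (φ : ℝ[X]) {m : ℤ}
    (hm : ω (pt q (2 * m)) ≠ 0) : defect hω g φ (2 * m) = 0 := by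
  have hconst : ∀ k : ℕ, ω (pt q (2 * (m + k))) ≠ 0 ∧
      defect hω g φ (2 * (m + k)) = defect hω g φ (2 * m) := fun k => by
    induction k with
    | zero => simpa using hm
    | succ k ih =>
      have h1 := weight_succ_ne_zero hρ hω ih.1
      have h2 := weight_succ_ne_zero hρ hω h1
      have h3 := defect_step hq0 hq1 hρ hω φ h1
      rw [add_sub_cancel_right] at h3
      rw [Nat.cast_succ, show 2 * (m + ((k : ℤ) + 1)) = 2 * (m + k) + 1 + 1 by ring]
      exact ⟨h2, h3.trans ih.2⟩
  have h0 : Tendsto (fun j : ℤ => defect hω g φ (2 * j)) atTop (𝓝 0) := by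
    have h2 : Tendsto (fun j : ℤ => 2 * j) atTop atTop := by simpa using tendsto_two_mul_add 0
    have h := (tendsto_sLin_even_atTop hω.moments (polyA q f g φ)).sub
      (((tendsto_ratio_atTop hq1 hlim φ).comp h2).const_mul ((1 + √q) ^ 2))
    rw [mul_zero, sub_zero] at h
    exact h
  refine tendsto_nhds_unique (tendsto_const_nhds.congr' ?_) h0
  filter_upwards [eventually_ge_atTop m] with j hj
  have h := (hconst (j - m).toNat).2
  rw [Int.toNat_of_nonneg (by omega), add_sub_cancel] at h
  exact h.symm

/-- On the support of the weights, `s 𝒜 φ = (1 + √q)² (ρ / ω) φ`. -/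
theorem sLin_polyA (hq0 : 0 < q) (hq1 : q < 1) (hρ : IsQClassical q ρ f g)
    (hω : IsSkewWeight q ρ f ω)
    (hlim : Tendsto (fun i : ℤ => ρ (pt q i) / ω (pt q i)) atTop (𝓝 0)) (φ : ℝ[X]) {j : ℤ}
    (hj : ω (pt q j) ≠ 0) :
    sLin hω.moments (polyA q f g φ) j =
      (1 + √q) ^ 2 * (ρ (pt q j) / ω (pt q j) * φ.eval (pt q j)) := by
  rw [← sub_eq_zero]
  rcases Int.even_or_odd' j with ⟨m, rfl | rfl⟩
  · exact defect_even hq0 hq1 hρ hω hlim φ hj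
  · exact defect_odd hq0 hq1 hρ hω φ m

theorem betaLin_polyA (hq0 : 0 < q) (hq1 : q < 1) (hρ : IsQClassical q ρ f g)
    (hω : IsSkewWeight q ρ f ω)
    (hlim : Tendsto (fun i : ℤ => ρ (pt q i) / ω (pt q i)) atTop (𝓝 0)) (φ : ℝ[X]) :
    betaLin hω.moments (polyA q f g φ) = 0 := by
  have h1 := tendsto_sLin_odd_atTop hω.moments (polyA q f g φ)
  have h2 := ((tendsto_ratio_atTop hq1 hlim φ).comp (tendsto_two_mul_add 1)).const_mul
    ((1 + √q) ^ 2)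
  rw [mul_zero] at h2
  have h3 := tendsto_nhds_unique (h1.congr fun m => sub_eq_zero.1 (defect_odd hq0 hq1 hρ hω φ m)) h2
  exact (mul_eq_zero.1 h3).resolve_left (by have := Real.sqrt_nonneg q; linarith)

theorem skewForm_polyA (hq0 : 0 < q) (hq1 : q < 1) (hρ : IsQClassical q ρ f g)
    (hω : IsSkewWeight q ρ f ω)
    (hlim : Tendsto (fun i : ℤ => ρ (pt q i) / ω (pt q i)) atTop (𝓝 0)) (φ ψ : ℝ[X]) :
    skewForm hω.moments (polyA q f g φ) ψ = (1 + √q) ^ 2 * innerForm hρ.moments φ ψ := by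
  rw [skewForm_eq, innerForm_apply, inner2, ← qInt_const_mul]
  congr 1
  ext j
  have h := ratio_mul hω j
  by_cases hj : ω (pt q j) = 0
  · rw [hj, mul_zero] at h
    rw [hj, ← h]
    ring
  · rw [sLin_polyA hq0 hq1 hρ hω hlim φ hj, ← h]
    field_simp

theorem isSkewLadder {p : ℕ → ℝ[X]} (hq0 : 0 < q) (hq1 : q < 1) (hρ : IsQClassical q ρ f g)
    (hω : IsSkewWeight q ρ f ω) (hp : IsMonicOP q ρ p)
    (hlim : Tendsto (fun i : ℤ => ρ (pt q i) / ω (pt q i)) atTop (𝓝 0)) :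
    IsSkewLadder ((1 + √q) ^ 2) (polyA q f g) (innerForm hρ.moments) (skewForm hω.moments) p where
  kappa_ne := by positivity
  monic := hp.monic
  natDegree_eq := hp.natDegree_eq
  orth := hp.orthogonal
  norm_ne := hp.norm_ne_zero
  skew := skewForm_skew _
  adj := skewForm_polyA hq0 hq1 hρ hω hlim
  degree_lt := degree_polyA_lt hρ.natDegree_f hρ.natDegree_g

theorem isSkewOrtho {Q : ℕ → ℝ[X]} (hω : HasMoments q ω) (hQ : IsMonicSOP q ω Q) :
    IsSkewOrtho (skewForm hω) Q where
  monic := hQ.monic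
  natDegree_eq := hQ.natDegree_eq
  skew := skewForm_skew _
  even_even := hQ.even_even
  odd_odd := hQ.odd_odd
  even_odd := hQ.even_odd
  ne_zero := hQ.u_ne_zero

/-! ### The kernels and the final formulas -/

open IsSkewLadder

theorem J_eq (hω : HasMoments q ω) (Q : ℕ → ℝ[X]) (n : ℕ) (i : ℤ) (y : ℝ) :
    J q ω Q n i y = sLin hω (skewKernel (skewForm hω) Q n y) i := by
  rw [J, sLin_apply]
  congr 1
  ext z
  rw [K, skewKernel, eval_finsetSum]
  refine Finset.sum_congr rfl fun k _ => ?_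
  simp only [eval_smul, eval_sub, smul_eq_mul, skewForm_apply, u]
  ring

/-- The odd kernel in terms of the even one and the representer of `φ ↦ ∫ F φ ω`. -/
theorem Jodd_eq (hω : HasMoments q ω) (Q : ℕ → ℝ[X]) (n : ℕ) (i : ℤ) (y : ℝ) :
    Jodd q ω Q n i y = J q ω Q n i y +
      1 / bet q ω Q (2 * n) * F q i * (Q (2 * n)).eval y -
      1 / bet q ω Q (2 * n) *
        (sLin hω (Q (2 * n)) i *
          (skewDual (skewForm hω) Q n fun k => betaLin hω (Q k)).eval y -
        sLin hω (skewDual (skewForm hω) Q n fun k => betaLin hω (Q k)) i *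
          (Q (2 * n)).eval y) := by
  have hhat : ∀ k < 2 * n, Qhat q ω Q n k =
      Q k - (bet q ω Q k / bet q ω Q (2 * n)) • Q (2 * n) := fun k hk => by
    rw [Qhat, if_pos hk, smul_eq_C_mul]
  have hPhi : ∀ k < 2 * n, Phi q ω Q n k i =
      sLin hω (Q k) i - bet q ω Q k / bet q ω Q (2 * n) * sLin hω (Q (2 * n)) i := fun k hk => by
    rw [Phi, ← sLin_apply hω, hhat k hk, map_sub, map_smul]
    rfl
  have htop : Qhat q ω Q n (2 * n) = Q (2 * n) := by
    rw [Qhat, if_neg (lt_irrefl _)]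
  rw [Jodd, htop, J_eq hω, add_sub_right_comm]
  congr 1
  simp only [skewKernel, skewDual, map_sum, Finset.sum_apply, eval_finsetSum, Finset.mul_sum,
    Finset.sum_mul, ← Finset.sum_sub_distrib]
  -- In each summand the terms quadratic in 1/β_{2n} cancel by skew symmetry; the linear ones
  -- assemble the representer of φ ↦ ∫Fφω.
  refine Finset.sum_congr rfl fun k hk => ?_
  have hk' := Finset.mem_range.1 hk
  rw [hPhi _ (by omega), hPhi _ (by omega), hhat _ (by omega), hhat _ (by omega)]
  simp only [map_smul, map_sub, Pi.smul_apply, Pi.sub_apply, eval_smul, eval_sub, smul_eq_mul]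
  have hu : skewForm hω (Q (2 * k)) (Q (2 * k + 1)) = u q ω Q k := rfl
  have hb : ∀ j, betaLin hω (Q j) = bet q ω Q j := fun _ => rfl
  rw [hu, hb, hb]
  ring

theorem J_eq_ladder {p Q : ℕ → ℝ[X]} (hq0 : 0 < q) (hq1 : q < 1) (hρ : IsQClassical q ρ f g)
    (hω : IsSkewWeight q ρ f ω) (hp : IsMonicOP q ρ p) (hQ : IsMonicSOP q ω Q)
    (hlim : Tendsto (fun i : ℤ => ρ (pt q i) / ω (pt q i)) atTop (𝓝 0)) (m : ℕ) {i : ℤ}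
    (hi : ω (pt q i) ≠ 0) (y : ℝ) :
    J q ω Q (m + 1) i y =
      ρ (pt q i) / ω (pt q i) * S q ρ p (2 * m + 1) (pt q i) y +
        1 / u q ω Q m * sLin hω.moments (p (2 * m)) i * (p (2 * m + 1)).eval y := by
  have hκ : (1 + √q) ^ 2 ≠ 0 := by positivity
  rw [J_eq hω.moments, (isSkewLadder hq0 hq1 hρ hω hp hlim).skewKernel_eq_ladder
    (isSkewOrtho hω.moments hQ), map_add, map_smul, map_smul, Pi.add_apply, Pi.smul_apply,
    Pi.smul_apply, sLin_polyA hq0 hq1 hρ hω hlim _ hi, smul_eq_mul, smul_eq_mul,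
    inv_mul_cancel_left₀ hκ]
  congr 1
  · congr 1
    rw [S, eval_finsetSum]
    refine Finset.sum_congr rfl fun l _ => ?_
    rw [eval_smul, smul_eq_mul, innerForm_apply, h]
    ring
  · rw [skewForm_apply, u]
    ring

theorem c_eq (hq0 : 0 < q) (hq1 : q < 1) (hρ : HasMoments q ρ) (p : ℕ → ℝ[X]) (j : ℕ) :
    c q ρ f g p j = -innerForm hρ (p (j + 1)) (polyA q f g (p j)) := by
  rw [c, innerForm_apply, inner2, inner2]
  congr 2
  ext i
  rw [opA_eq_eval hq0 hq1 _ (pt_pos hq0 i).ne']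

theorem gam_even_eq {p Q : ℕ → ℝ[X]} (hq0 : 0 < q) (hq1 : q < 1) (hρ : IsQClassical q ρ f g)
    (hω : IsSkewWeight q ρ f ω) (hp : IsMonicOP q ρ p) (hQ : IsMonicSOP q ω Q)
    (hlim : Tendsto (fun i : ℤ => ρ (pt q i) / ω (pt q i)) atTop (𝓝 0)) (m : ℕ) :
    gam q ρ f g p (2 * m) = 1 / u q ω Q m := by
  have H := isSkewLadder hq0 hq1 hρ hω hp hlim
  have hS := isSkewOrtho hω.moments hQ
  have h1 := H.form_even_odd m
  rw [← H.skewNorm_eq hS] at h1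
  have h2 := hQ.u_ne_zero m
  have h3 : (1 + √q) ^ 2 * h q ρ p (2 * m) * h q ρ p (2 * m + 1) ≠ 0 :=
    mul_ne_zero (mul_ne_zero H.kappa_ne (hp.norm_ne_zero _)) (hp.norm_ne_zero _)
  rw [gam, div_eq_div_iff h3 h2, c_eq hq0 hq1 hρ.moments]
  change _ * u q ω Q m = -((1 + √q) ^ 2 * h q ρ p (2 * m) * h q ρ p (2 * m + 1)) at h1
  linear_combination -h1

end QOrtho

end

theorem mainTheorem7 (q : ℝ) (hq0 : 0 < q) (hq1 : q < 1)
    (ρ ω : ℝ → ℝ) (f g : Polynomial ℝ) (p Q : ℕ → Polynomial ℝ)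
    (hρ : QOrtho.IsQClassical q ρ f g) (hω : QOrtho.IsSkewWeight q ρ f ω)
    (hp : QOrtho.IsMonicOP q ρ p) (hQ : QOrtho.IsMonicSOP q ω Q)
    (hlim : Filter.Tendsto (fun i : ℤ => ρ (QOrtho.pt q i) / ω (QOrtho.pt q i))
      Filter.atTop (nhds 0))
    (n : ℕ) (hn : 1 ≤ n) (hβ : QOrtho.bet q ω Q (2 * n) ≠ 0) (i : ℤ) (y : ℝ) :
    QOrtho.Jodd q ω Q n i y =
        QOrtho.J q ω Q n i y
          + 1 / QOrtho.bet q ω Q (2 * n) * QOrtho.F q i * (p (2 * n)).eval y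
          - QOrtho.bet q ω Q (2 * n - 2) / (QOrtho.u q ω Q (n - 1) * QOrtho.bet q ω Q (2 * n)) *
            (QOrtho.sOp q ω (fun z => (p (2 * n)).eval z) i * (p (2 * n - 1)).eval y
              - QOrtho.sOp q ω (fun z => (p (2 * n - 1)).eval z) i * (p (2 * n)).eval y) ∧
    (ρ (QOrtho.pt q i) ≠ 0 →
      QOrtho.Jodd q ω Q n i y =
        ρ (QOrtho.pt q i) / ω (QOrtho.pt q i) * QOrtho.S q ρ p (2 * n - 1) (QOrtho.pt q i) y
          + QOrtho.gam q ρ f g p (2 * n - 2) *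
            QOrtho.sOp q ω (fun z => (p (2 * n - 2)).eval z) i * (p (2 * n - 1)).eval y
          + 1 / QOrtho.bet q ω Q (2 * n) * QOrtho.F q i * (p (2 * n)).eval y
          - QOrtho.bet q ω Q (2 * n - 2) / (QOrtho.u q ω Q (n - 1) * QOrtho.bet q ω Q (2 * n)) *
            (QOrtho.sOp q ω (fun z => (p (2 * n)).eval z) i * (p (2 * n - 1)).eval y
              - QOrtho.sOp q ω (fun z => (p (2 * n - 1)).eval z) i * (p (2 * n)).eval y)) := by
  obtain ⟨m, rfl⟩ : ∃ m, n = m + 1 := ⟨n - 1, by omega⟩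
  have H := QOrtho.isSkewLadder hq0 hq1 hρ hω hp hlim
  have hS := QOrtho.isSkewOrtho hω.moments hQ
  have hodd := QOrtho.Jodd_eq hω.moments Q (m + 1) i y
  rw [H.skewDual_eq hS m (QOrtho.betaLin hω.moments)
    (QOrtho.betaLin_polyA hq0 hq1 hρ hω hlim), H.even_eq hS] at hodd
  have e1 : 2 * (m + 1) - 2 = 2 * m := by omega
  have e2 : 2 * (m + 1) - 1 = 2 * m + 1 := by omega
  rw [e1, e2, Nat.add_sub_cancel]
  have hfirst : QOrtho.Jodd q ω Q (m + 1) i y =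
      QOrtho.J q ω Q (m + 1) i y
        + 1 / QOrtho.bet q ω Q (2 * (m + 1)) * QOrtho.F q i * (p (2 * (m + 1))).eval y
        - QOrtho.bet q ω Q (2 * m) / (QOrtho.u q ω Q m * QOrtho.bet q ω Q (2 * (m + 1))) *
          (QOrtho.sOp q ω (fun z => (p (2 * (m + 1))).eval z) i * (p (2 * m + 1)).eval y
            - QOrtho.sOp q ω (fun z => (p (2 * m + 1)).eval z) i *
              (p (2 * (m + 1))).eval y) := by
    rw [hodd, map_smul, Pi.smul_apply, Polynomial.eval_smul, smul_eq_mul, smul_eq_mul,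
      ← QOrtho.sLin_apply hω.moments, ← QOrtho.sLin_apply hω.moments]
    change _ - _ * (_ * (QOrtho.bet q ω Q (2 * m) / QOrtho.u q ω Q m * _) -
      QOrtho.bet q ω Q (2 * m) / QOrtho.u q ω Q m * _ * _) = _
    have hu := hQ.u_ne_zero m
    field_simp
  refine ⟨hfirst, fun hi => ?_⟩
  rw [hfirst, QOrtho.J_eq_ladder hq0 hq1 hρ hω hp hQ hlim m ((hω.support_iff i).2 hi),
    QOrtho.gam_even_eq hq0 hq1 hρ hω hp hQ hlim, QOrtho.sLin_apply]
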